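/- Theorem 1.3. Let $n\ge 1$, $1<p<\infty$, $p'=p/(p-1)$ and $0<\kappa<1$. Cubes $Q\subset\mathbb R^n$ have sides parallel to the axes, $|Q|$ is Lebesgue measure, a weight is a nonnegative locally integrable function on $\mathbb R^n$, and $w(E)=\int_E w(x)\,dx$. Let $w,\nu$ be weights; a negative power of a weight is $\infty$ where the weight vanishes, and $0\cdot\infty=0$. Let $L^{p,\kappa}(\nu,w)$ be the space of measurable $f\in L^p_{loc}(\nu)$ with $$\|f\|_{L^{p,\kappa}(\nu,w)}=\sup_Q\Big(\frac1{w(Q)^{\kappa}}\int_Q|f(x)|^p\nu(x)\,dx\Big)^{1/p}<\infty ,$$ and $WL^{p,\kappa}(w)$ the space of measurable $g$ with $$\|g\|_{WL^{p,\kappa}(w)}=\sup_Q\sup_{\sigma>0}\frac{\sigma}{w(Q)^{\kappa/p}}\,w(\{x\in Q:|g(x)|>\sigma\})^{1/p}<\infty .$$ Let $b\in \mathrm{BMO}(\mathbb R^n)$, that is, $b$ is locally integrable and $\sup_Q\frac1{|Q|}\int_Q|b(x)-b_Q|\,dx<\infty$ with $b_Q=\frac1{|Q|}\int_Q b$. Let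 $[b,\mathcal T]$ be a linear or sublinear operator with measurable values (sublinear: $|S(f+g)|\le|Sf|+|Sg|$ and $|S(af)|=|a||Sf|$ almost everywhere), defined on a class of measurable functions that contains the integrable functions with compact support, $L^p(\nu)$ and $L^{p,\kappa}(\nu,w)$. Assume the following. 1. (Size condition.) There is a constant $c_3$ such that for every $f$ that is integrable with compact support or belongs to $L^{p,\kappa}(\nu,w)$, $$|[b,\mathcal T](f)(x)|\le c_3\int_{\mathbb R^n}\frac{|b(x)-b(y)|\,|f(y)|}{|x-y|^n}\,dy\qquad\text{for almost every }x\notin\operatorname{supp} f .$$ 2. (Bump condition $(\S\S)$.) For some $r>1$ there is a constant $C<\infty$ such that for all cubes $Q$ $$\Big(\frac1{|Q|}\int_Q w(x)^r\,dx\Big)^{1/(rp)}\big\|\nu^{-1/p}\big\|_{\mathcal A,Q}\le C,$$ where $\mathcal A(t)=t^{p'}[\log(e+t)]^{p'}$ and $\|g\|_{\mathcal A,Q}=\inf\{\lambda>0:\frac1{|Q|}\int_Q\mathcal A(|g(x)|/\lambda)\,dx\le1\}$. 3. (Weak type $(p,p)$.) There is a constant $C$ such that for all $f\in L^p(\nu)$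 and all $\sigma>0$ $$w(\{x\in\mathbb R^n:|[b,\mathcal T](f)(x)|>\sigma\})\le\frac{C}{\sigma^p}\int_{\mathbb R^n}|f(x)|^p\nu(x)\,dx .$$ 4. $w\in A_\infty$, that is, for some $1<q<\infty$ with $q'=q/(q-1)$ the products $\big(\frac1{|Q|}\int_Q w\big)^{1/q}\big(\frac1{|Q|}\int_Q w^{-q'/q}\big)^{1/q'}$ are bounded uniformly in the cubes $Q$. Then $[b,\mathcal T]$ is bounded from $L^{p,\kappa}(\nu,w)$ to $WL^{p,\kappa}(w)$: there is a constant $C$ such that for every $f\in L^{p,\kappa}(\nu,w)$ one has $[b,\mathcal T](f)\in WL^{p,\kappa}(w)$ and $\|[b,\mathcal T](f)\|_{WL^{p,\kappa}(w)}\le C\|f\|_{L^{p,\kappa}(\nu,w)}$. -/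

import Mathlib

open MeasureTheory
open scoped ENNReal NNReal

noncomputable section

namespace WeightedMorrey

/-- `ℝⁿ` with its Euclidean norm. -/
abbrev E (n : ℕ) : Type := EuclideanSpace ℝ (Fin n)

/-- The (closed) cube `Q(x₀, ℓ)` with centre `x₀`, side length `ℓ` and sides parallel to the
coordinate axes. -/
def cube {n : ℕ} (x₀ : E n) (l : ℝ) : Set (E n) :=
  {x | ∀ i, |x i - x₀ i| ≤ l / 2}

/-- The mean value `|Q|⁻¹ ∫_Q g(x) dx` of a function `g` with values in `[0, ∞]`. -/
def avg {n : ℕ} (Q : Set (E n)) (g : E n → ℝ≥0∞) : ℝ≥0∞ :=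
  (volume Q)⁻¹ * ∫⁻ x in Q, g x

/-! ### Weights

All integrals of nonnegative functions are taken in `[0, ∞]`, and `0 ^ (-s) = ∞` there for
`s > 0`, so a negative power of a weight is infinite where the weight vanishes. -/

/-- A weight is a nonnegative locally integrable function. -/
structure IsWeight {n : ℕ} (w : E n → ℝ) : Prop where
  nonneg : ∀ x, 0 ≤ w x
  locallyIntegrable : LocallyIntegrable w volume

/-- `w(S) = ∫_S w(x) dx`. -/
def wmass {n : ℕ} (w : E n → ℝ) (S : Set (E n)) : ℝ≥0∞ :=
  ∫⁻ x in S, ENNReal.ofReal (w x)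

/-- The Muckenhoupt condition `A_q`, where `q' = q / (q - 1)` is `Real.conjExponent q`. -/
def MuckenhouptA {n : ℕ} (q : ℝ) (w : E n → ℝ) : Prop :=
  ∃ C : ℝ≥0, ∀ (x₀ : E n) (l : ℝ), 0 < l →
    (avg (cube x₀ l) fun x => ENNReal.ofReal (w x)) ^ (1 / q) *
      (avg (cube x₀ l) fun x => ENNReal.ofReal (w x) ^ (-(q.conjExponent / q)))
        ^ (1 / q.conjExponent) ≤ C

/-- `A_∞` is the union of the classes `A_q`, `1 < q < ∞`. -/
def MuckenhouptAInfty {n : ℕ} (w : E n → ℝ) : Prop :=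
  ∃ q : ℝ, 1 < q ∧ MuckenhouptA q w

/-! ### Orlicz averages -/

/-- The Young function `𝒜(t) = t^s [log (e + t)]^s`. -/
def youngLog (s t : ℝ) : ℝ :=
  t ^ s * Real.log (Real.exp 1 + t) ^ s

/-- A Young function, extended to `[0, ∞]` by the value `∞` at `∞`. -/
def youngExt (A : ℝ → ℝ) (t : ℝ≥0∞) : ℝ≥0∞ :=
  if t = ⊤ then ⊤ else ENNReal.ofReal (A t.toReal)

/-- The Luxemburg average `‖g‖_{A,Q} = inf {t > 0 : |Q|⁻¹ ∫_Q A(g(x) / t) dx ≤ 1}` of a function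
`g` with values in `[0, ∞]`; it is `∞` if there is no such real number `t`. -/
def luxemburg {n : ℕ} (A : ℝ → ℝ) (Q : Set (E n)) (g : E n → ℝ≥0∞) : ℝ≥0∞ :=
  ⨅ (t : ℝ≥0) (_ : 0 < t ∧ avg Q (fun x => youngExt A (g x / t)) ≤ 1), (t : ℝ≥0∞)

/-- The two-weight bump condition: for some `r > 1` and some finite `C`, and for all cubes `Q`,
`(|Q|⁻¹ ∫_Q w^r)^{1/(rp)} ‖ν^{-1/p}‖_{𝒜,Q} ≤ C`, where `𝒜(t) = t^{p'} [log (e + t)]^{p'}`. -/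
def BumpCondition {n : ℕ} (p : ℝ) (w ν : E n → ℝ) : Prop :=
  ∃ r : ℝ, 1 < r ∧ ∃ C : ℝ≥0, ∀ (x₀ : E n) (l : ℝ), 0 < l →
    (avg (cube x₀ l) fun x => ENNReal.ofReal (w x) ^ r) ^ (1 / (r * p)) *
      luxemburg (youngLog p.conjExponent) (cube x₀ l)
        (fun x => ENNReal.ofReal (ν x) ^ (-(1 / p))) ≤ C

/-! ### Function spaces -/

section Spaces

variable {𝕜 : Type*} [RCLike 𝕜] {n : ℕ}

/-- `‖b‖_* = sup_Q |Q|⁻¹ ∫_Q |b - b_Q|`. -/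
def bmoNorm (b : E n → 𝕜) : ℝ≥0∞ :=
  ⨆ (x₀ : E n) (l : ℝ) (_ : 0 < l),
    avg (cube x₀ l) fun x => ‖b x - ⨍ y in cube x₀ l, b y‖ₑ

/-- `b ∈ BMO(ℝⁿ)`. -/
structure MemBMO (b : E n → 𝕜) : Prop where
  locallyIntegrable : LocallyIntegrable b volume
  norm_lt_top : bmoNorm b < ⊤

/-- `∫_S |f|^p ν dx`. -/
def wpow (p : ℝ) (ν : E n → ℝ) (f : E n → 𝕜) (S : Set (E n)) : ℝ≥0∞ :=
  ∫⁻ x in S, ‖f x‖ₑ ^ p * ENNReal.ofReal (ν x)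

/-- `f ∈ L^p(ν)`. -/
structure MemWeightedLp (p : ℝ) (ν : E n → ℝ) (f : E n → 𝕜) : Prop where
  measurable : AEStronglyMeasurable f volume
  lt_top : wpow p ν f Set.univ < ⊤

/-- The norm of `L^{p,κ}(ν, w)`: `sup_Q (w(Q)^{-κ} ∫_Q |f|^p ν dx)^{1/p}`. -/
def morreyNorm (p κ : ℝ) (ν w : E n → ℝ) (f : E n → 𝕜) : ℝ≥0∞ :=
  ⨆ (x₀ : E n) (l : ℝ) (_ : 0 < l),
    ((wmass w (cube x₀ l) ^ κ)⁻¹ * wpow p ν f (cube x₀ l)) ^ (1 / p)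

/-- `f ∈ L^{p,κ}(ν, w)`: `f` is measurable, lies in `L^p_loc(ν)`, and has finite norm. -/
structure MemMorrey (p κ : ℝ) (ν w : E n → ℝ) (f : E n → 𝕜) : Prop where
  measurable : AEStronglyMeasurable f volume
  locally : ∀ (x₀ : E n) (l : ℝ), 0 < l → wpow p ν f (cube x₀ l) < ⊤
  norm_lt_top : morreyNorm p κ ν w f < ⊤

/-- The norm of `WL^{p,κ}(w)`:
`sup_Q sup_{σ>0} w(Q)^{-κ/p} σ w({x ∈ Q : |g(x)| > σ})^{1/p}`. -/
def weakMorreyNorm (p κ : ℝ) (w : E n → ℝ) (g : E n → 𝕜) : ℝ≥0∞ :=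
  ⨆ (x₀ : E n) (l : ℝ) (_ : 0 < l) (σ : ℝ) (_ : 0 < σ),
    (wmass w (cube x₀ l) ^ (κ / p))⁻¹ * ENNReal.ofReal σ *
      wmass w {x | x ∈ cube x₀ l ∧ σ < ‖g x‖} ^ (1 / p)

/-- `g ∈ WL^{p,κ}(w)`. -/
structure MemWeakMorrey (p κ : ℝ) (w : E n → ℝ) (g : E n → 𝕜) : Prop where
  measurable : AEStronglyMeasurable g volume
  norm_lt_top : weakMorreyNorm p κ w g < ⊤

/-! ### Operators

An operator is a map `S` on functions, about which something is assumed only on the classes of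
functions that are named; its values elsewhere are irrelevant. -/

/-- `S` is a sublinear operator from the class `F` to measurable functions. Linear operators are
a special case. -/
structure IsSublinearOn (F : (E n → 𝕜) → Prop) (S : (E n → 𝕜) → E n → 𝕜) : Prop where
  measurable : ∀ f, F f → AEStronglyMeasurable (S f) volume
  add_le : ∀ f g, F f → F g → ∀ᵐ x, ‖S (f + g) x‖ ≤ ‖S f x‖ + ‖S g x‖
  smul_eq : ∀ (a : 𝕜) (f), F f → ∀ᵐ x, ‖S (a • f) x‖ = ‖a‖ * ‖S f x‖

/-- The size condition of a commutator with symbol `b`, for the functions `f` of the class `F`: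
`|S f(x)| ≤ c ∫ |b(x) - b(y)| |f(y)| / |x - y|^n dy` for almost every `x ∉ supp f`. -/
def CommutatorSize (F : (E n → 𝕜) → Prop) (b : E n → 𝕜) (S : (E n → 𝕜) → E n → 𝕜) : Prop :=
  ∃ c : ℝ≥0, ∀ f, F f → ∀ᵐ x, x ∉ tsupport f →
    ‖S f x‖ₑ ≤ c * ∫⁻ y, ‖b x - b y‖ₑ * ‖f y‖ₑ / ‖x - y‖ₑ ^ n

/-- The weak type `(p, p)` inequality from `L^p(ν)` to `WL^p(w)`. -/
def WeakType (p : ℝ) (ν w : E n → ℝ) (S : (E n → 𝕜) → E n → 𝕜) : Prop :=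
  ∃ C : ℝ≥0, ∀ f, MemWeightedLp p ν f → ∀ σ : ℝ, 0 < σ →
    wmass w {x | σ < ‖S f x‖} ≤ C / ENNReal.ofReal σ ^ p * wpow p ν f Set.univ

/-- `S` is bounded from `L^{p,κ}(ν, w)` to `WL^{p,κ}(w)`. -/
def BoundedMorreyToWeak (p κ : ℝ) (ν w : E n → ℝ) (S : (E n → 𝕜) → E n → 𝕜) : Prop :=
  ∃ C : ℝ≥0, ∀ f, MemMorrey p κ ν w f →
    MemWeakMorrey p κ w (S f) ∧ weakMorreyNorm p κ w (S f) ≤ C * morreyNorm p κ ν w f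

end Spaces

end WeightedMorrey

end

open WeightedMorrey

namespace WeightedMorrey

variable {n : ℕ}

/-! Fix a cube `Q` with `w(Q) ≠ 0` and split `f = f₁ + f₂`, where `f₁` is the restriction of `f` to
`2Q`. For `f₁` the weak type inequality leaves `∫_{2Q} |f|^p ν`, which the Morrey norm bounds by a
multiple of `w(2Q)^κ`, and doubling of `w` replaces `2Q` by `Q`.

For `f₂` the size condition applies on `Q`. On the annulus between `2^{j+1}Q` and `Q' = 2^{j+2}Q`
the kernel is at most a constant over `|Q'|`, and `b(x) - b(y)` is compared with the means of `b`
over `Q` and `Q'`, which differ by `O(j+2)`. What remains is the average over `Q'` of `(1 + |b -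
b_{Q'}|)|f|`. Exponential integrability of `b` and the bump condition bound it by a multiple of `‖f‖
w(Q')^{(κ-1)/p}` (`BumpCondition.exists_avg_le`). Since `w(Q) ≤ β^{j+2} w(Q')` with `β < 1`, and `κ
< 1`, the sum over `j` converges (`exists_lintegral_compl_cube_le`). So `|S f₂|` is at most a
multiple of `‖f‖ w(Q)^{(κ-1)/p} (1 + |b - b_Q|)` almost everywhere on `Q`, and Chebyshev's
inequality finishes, because the `p`-th moment of `1 + |b - b_Q|` with respect to `w` is `O(w(Q))`.

Exponential integrability is thus needed for Lebesgue measure and for `w dx`. Both come from one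
John–Nirenberg argument (`HalfSpread.john_nirenberg`), whose only demand on an absolutely continuous
measure is `HalfSpread`; for `w` this follows from `A_∞`. -/

/-! ### Cubes -/

/-- The half-open cube with centre `x₀` and side length `l`. -/
def halfCube (x₀ : E n) (l : ℝ) : Set (E n) :=
  {x | ∀ i, x₀ i - l / 2 ≤ x i ∧ x i < x₀ i + l / 2}

lemma cube_eq_preimage_closedBall (x₀ : E n) {l : ℝ} (hl : 0 ≤ l) :
    cube x₀ l = (MeasurableEquiv.toLp 2 (Fin n → ℝ)).symm ⁻¹'
      Metric.closedBall (fun i => x₀ i) (l / 2) := by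
  ext x
  simp only [cube, Set.mem_ofPred_eq, Set.mem_preimage, Metric.mem_closedBall]
  rw [dist_pi_le_iff (by positivity)]
  rfl

lemma measurableSet_cube (x₀ : E n) (l : ℝ) : MeasurableSet (cube x₀ l) := by
  have : cube x₀ l = ⋂ i, {x : E n | |x i - x₀ i| ≤ l / 2} := by
    ext x; simp [cube]
  rw [this]
  exact MeasurableSet.iInter fun i => measurableSet_le (by fun_prop) (by fun_prop)

lemma measurableSet_halfCube (x₀ : E n) (l : ℝ) : MeasurableSet (halfCube x₀ l) := by
  have : halfCube x₀ l =
      ⋂ i, ({x : E n | x₀ i - l / 2 ≤ x i} ∩ {x : E n | x i < x₀ i + l / 2}) := by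
    ext x; simp [halfCube]
  rw [this]
  exact MeasurableSet.iInter fun i => (measurableSet_le (by fun_prop) (by fun_prop)).inter
    (measurableSet_lt (by fun_prop) (by fun_prop))

lemma volume_cube (x₀ : E n) {l : ℝ} (hl : 0 ≤ l) :
    volume (cube x₀ l) = ENNReal.ofReal (l ^ n) := by
  rw [cube_eq_preimage_closedBall x₀ hl,
    (EuclideanSpace.volume_preserving_symm_measurableEquiv_toLp (Fin n)).measure_preimage_equiv,
    Real.volume_pi_closedBall _ (by positivity)]
  simp [mul_div_cancel₀]

lemma volume_halfCube (x₀ : E n) {l : ℝ} (hl : 0 ≤ l) :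
    volume (halfCube x₀ l) = ENNReal.ofReal (l ^ n) := by
  have : halfCube x₀ l = (MeasurableEquiv.toLp 2 (Fin n → ℝ)).symm ⁻¹'
      (Set.univ.pi fun i => Set.Ico (x₀ i - l / 2) (x₀ i + l / 2)) := by
    ext x
    simp only [halfCube, Set.mem_ofPred_eq, Set.mem_preimage, Set.mem_pi, Set.mem_univ,
      forall_const, Set.mem_Ico]
    rfl
  rw [this,
    (EuclideanSpace.volume_preserving_symm_measurableEquiv_toLp (Fin n)).measure_preimage_equiv,
    Real.volume_pi_Ico]
  have h : ∀ i : Fin n, x₀ i + l / 2 - (x₀ i - l / 2) = l := fun i => by ring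
  simp [h, ENNReal.ofReal_pow hl]

lemma volume_cube_ne_top (x₀ : E n) {l : ℝ} (hl : 0 < l) : volume (cube x₀ l) ≠ ⊤ := by
  rw [volume_cube x₀ hl.le]; exact ENNReal.ofReal_ne_top

lemma volume_cube_ne_zero (x₀ : E n) {l : ℝ} (hl : 0 < l) : volume (cube x₀ l) ≠ 0 := by
  rw [volume_cube x₀ hl.le]; exact (ENNReal.ofReal_pos.2 (by positivity)).ne'

lemma halfCube_subset_cube (x₀ : E n) (l : ℝ) : halfCube x₀ l ⊆ cube x₀ l := fun x hx i =>
  abs_le.2 ⟨by linarith [(hx i).1], by linarith [(hx i).2]⟩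

/-- Equal finite volumes and an inclusion. This lets the dyadic bookkeeping use half-open cubes,
which are truly disjoint, while averages are taken over closed ones. -/
lemma halfCube_ae_eq_cube (x₀ : E n) {l : ℝ} (hl : 0 < l) :
    halfCube x₀ l =ᵐ[volume] cube x₀ l :=
  ae_eq_of_subset_of_measure_ge (halfCube_subset_cube x₀ l)
    (by rw [volume_cube x₀ hl.le, volume_halfCube x₀ hl.le])
    (measurableSet_halfCube x₀ l).nullMeasurableSet (volume_cube_ne_top x₀ hl)

lemma cube_subset_cube (x₀ : E n) {l l' : ℝ} (h : l ≤ l') : cube x₀ l ⊆ cube x₀ l' :=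
  fun _ hx i => (hx i).trans (by linarith)

lemma isCompact_cube (x₀ : E n) {l : ℝ} (hl : 0 ≤ l) : IsCompact (cube x₀ l) := by
  have : cube x₀ l = (PiLp.homeomorph 2 (fun _ : Fin n => ℝ)) ⁻¹'
      Metric.closedBall (fun i => x₀ i) (l / 2) := cube_eq_preimage_closedBall x₀ hl
  rw [this]
  exact (Homeomorph.isCompact_preimage _).2 (isCompact_closedBall _ _)

/-! ### The dyadic subdivision of a cube -/

/-- The centre of the dyadic child, of the cube with centre `c` and side `l`, which holds `x`. -/
noncomputable def childCentre (c : E n) (l : ℝ) (x : E n) : E n :=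
  WithLp.toLp 2 fun i => if x i < c i then c i - l / 4 else c i + l / 4

/-- The centre of the dyadic subcube of generation `k` which holds `x`. -/
noncomputable def dyadicCentre (c : E n) (l : ℝ) (x : E n) : ℕ → E n
  | 0 => c
  | k + 1 => childCentre (dyadicCentre c l x k) (l / 2 ^ k) x

lemma halfCube_childCentre_subset (c : E n) {l : ℝ} (hl : 0 < l) (x : E n) :
    halfCube (childCentre c l x) (l / 2) ⊆ halfCube c l := by
  intro y hy i
  have := hy i
  simp only [childCentre] at this
  split_ifs at this <;> constructor <;> linarith

lemma mem_halfCube_childCentre {c : E n} {l : ℝ} {x : E n} (hx : x ∈ halfCube c l) :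
    x ∈ halfCube (childCentre c l x) (l / 2) := by
  intro i
  have := hx i
  simp only [childCentre]
  split_ifs <;> constructor <;> linarith

/-- In each coordinate a half-open child lies wholly in `y i < c i` or wholly in `c i ≤ y i`. -/
lemma childCentre_eq {c : E n} {l : ℝ} {x y : E n}
    (hy : y ∈ halfCube (childCentre c l x) (l / 2)) : childCentre c l y = childCentre c l x := by
  ext i
  have := hy i
  simp only [childCentre] at this ⊢
  split_ifs at this ⊢ <;> first | rfl | linarith

lemma div_two_pow_succ (l : ℝ) (k : ℕ) : l / 2 ^ (k + 1) = l / 2 ^ k / 2 := by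
  rw [pow_succ]; ring

lemma mem_halfCube_dyadicCentre {c : E n} {l : ℝ} {x : E n} (hx : x ∈ halfCube c l) (k : ℕ) :
    x ∈ halfCube (dyadicCentre c l x k) (l / 2 ^ k) := by
  induction k with
  | zero => simpa [dyadicCentre] using hx
  | succ k ih => rw [div_two_pow_succ]; exact mem_halfCube_childCentre ih

lemma halfCube_dyadicCentre_succ_subset (c : E n) {l : ℝ} (hl : 0 < l) (x : E n) (k : ℕ) :
    halfCube (dyadicCentre c l x (k + 1)) (l / 2 ^ (k + 1)) ⊆
      halfCube (dyadicCentre c l x k) (l / 2 ^ k) := by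
  rw [div_two_pow_succ]
  exact halfCube_childCentre_subset _ (by positivity) x

lemma halfCube_dyadicCentre_subset (c : E n) {l : ℝ} (hl : 0 < l) (x : E n) (k : ℕ) :
    halfCube (dyadicCentre c l x k) (l / 2 ^ k) ⊆ halfCube c l := by
  induction k with
  | zero => simp [dyadicCentre]
  | succ k ih => exact (halfCube_dyadicCentre_succ_subset c hl x k).trans ih

/-- A dyadic cube determines its chain of ancestors; this is how nestedness of the grid enters the
stopping argument. -/
lemma dyadicCentre_eq {c : E n} {l : ℝ} (hl : 0 < l) {x y : E n} {k : ℕ}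
    (hy : y ∈ halfCube (dyadicCentre c l x k) (l / 2 ^ k)) {j : ℕ} (hj : j ≤ k) :
    dyadicCentre c l y j = dyadicCentre c l x j := by
  induction k generalizing j with
  | zero => obtain rfl : j = 0 := by omega
            rfl
  | succ k ih =>
    have h := fun j => ih (halfCube_dyadicCentre_succ_subset c hl x k hy) (j := j)
    rcases hj.lt_or_eq with hj | rfl
    · exact h j (by omega)
    · have h' : childCentre (dyadicCentre c l x k) (l / 2 ^ k) y = _ :=
        childCentre_eq (by rw [div_two_pow_succ] at hy; exact hy)
      change childCentre (dyadicCentre c l y k) _ y = _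
      rw [h k le_rfl, h']
      rfl

lemma countable_range_dyadicCentre (c : E n) (l : ℝ) (k : ℕ) :
    (Set.range fun x => dyadicCentre c l x k).Countable := by
  induction k with
  | zero => exact (Set.countable_singleton c).mono (by rintro _ ⟨x, rfl⟩; rfl)
  | succ k ih =>
    refine (ih.image2 (Set.countable_univ (α := Fin n → Bool)) fun d s =>
      (WithLp.toLp 2 fun i => if s i then d i - l / 2 ^ k / 4 else d i + l / 2 ^ k / 4 : E n)).mono
      ?_
    rintro _ ⟨x, rfl⟩
    refine ⟨_, ⟨x, rfl⟩, fun i => decide (x i < dyadicCentre c l x k i), trivial, ?_⟩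
    ext i
    simp [dyadicCentre, childCentre]

/-! ### Lebesgue differentiation along cubes -/

/-- In the sup norm on `Fin n → ℝ` cubes are closed balls, so differentiation for doubling measures
applies after a measure-preserving transfer. The cubes need only contain `x`, not be centred there,
which is what dyadic cubes require. -/
lemma ae_tendsto_average_cube {𝕜 : Type*} [RCLike 𝕜] {b : E n → 𝕜}
    (hb : LocallyIntegrable b volume) :
    ∀ᵐ x, ∀ (d : ℕ → E n) (l : ℕ → ℝ), (∀ k, 0 < l k) → Filter.Tendsto l Filter.atTop (nhds 0) →
      (∀ k, x ∈ cube (d k) (l k)) →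
        Filter.Tendsto (fun k => ⨍ y in cube (d k) (l k), b y) Filter.atTop (nhds (b x)) := by
  set e := (MeasurableEquiv.toLp 2 (Fin n → ℝ)).symm with he
  have hmp : MeasurePreserving e volume volume :=
    EuclideanSpace.volume_preserving_symm_measurableEquiv_toLp (Fin n)
  have hmp' : MeasurePreserving e.symm volume volume := hmp.symm e
  have hb' : LocallyIntegrable (b ∘ e.symm) volume := by
    rw [locallyIntegrable_iff]
    intro K hK
    rw [← hmp'.integrableOn_image e.symm.measurableEmbedding]
    exact hb.integrableOn_isCompact (hK.image (PiLp.continuous_toLp 2 _))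
  have h := IsUnifLocDoublingMeasure.ae_tendsto_average volume hb' 1
  have h2 := hmp.quasiMeasurePreserving.ae h
  filter_upwards [h2] with x hx d l hl hl0 hxd
  have h3 := hx (fun k i => d k i) (fun k => l k / 2)
    (tendsto_nhdsWithin_iff.2 ⟨by simpa using hl0.div_const 2,
      Filter.Eventually.of_forall fun k => by have := hl k; simp; linarith⟩)
    (Filter.Eventually.of_forall fun k => by
      have := hxd k
      rw [cube_eq_preimage_closedBall _ (hl k).le] at this
      rw [one_mul]
      exact this)
  have h4 : ∀ k, ⨍ y in cube (d k) (l k), b y =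
      ⨍ y in Metric.closedBall (fun i => d k i) (l k / 2), (b ∘ e.symm) y := by
    intro k
    rw [setAverage_eq, setAverage_eq, cube_eq_preimage_closedBall _ (hl k).le]
    congr 1
    · rw [measureReal_def, measureReal_def, hmp.measure_preimage_equiv]
    · rw [← hmp.setIntegral_preimage_emb e.measurableEmbedding]
      simp [he]
  simp_rw [h4]
  simpa using h3

/-! ### Weights of class `A_∞` -/

/-- The measure `w(x) dx`. -/
noncomputable def weightMeasure (w : E n → ℝ) : Measure (E n) :=
  volume.withDensity fun x => ENNReal.ofReal (w x)

lemma wmass_eq_weightMeasure (w : E n → ℝ) (S : Set (E n)) : wmass w S = weightMeasure w S :=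
  (withDensity_apply' _ S).symm

lemma weightMeasure_absolutelyContinuous (w : E n → ℝ) : weightMeasure w ≪ volume :=
  withDensity_absolutelyContinuous _ _

lemma IsWeight.aemeasurable {w : E n → ℝ} (hw : IsWeight w) : AEMeasurable w volume :=
  hw.locallyIntegrable.aestronglyMeasurable.aemeasurable

lemma IsWeight.wmass_cube_ne_top {w : E n → ℝ} (hw : IsWeight w) (x₀ : E n) {l : ℝ}
    (hl : 0 ≤ l) : wmass w (cube x₀ l) ≠ ⊤ := by
  have h := (hw.locallyIntegrable.integrableOn_isCompact (isCompact_cube x₀ hl)).2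
  rw [HasFiniteIntegral] at h
  refine ne_of_eq_of_ne ?_ h.ne
  simp only [wmass, ← ofReal_norm, Real.norm_eq_abs, abs_of_nonneg (hw.nonneg _)]

/-- Hölder's inequality for `1 = w^{1/q} w^{-1/q}` on `F` bounds `|F|` by `w(F)^{1/q}` times a dual
factor over `Q`, which `A_q` bounds by a multiple of `|Q| w(Q)^{-1/q}`. -/
lemma MuckenhouptA.exists_mul_wmass_le {w : E n → ℝ} (hw : IsWeight w) {q : ℝ} (hq : 1 < q)
    (h : MuckenhouptA q w) {ε : ℝ≥0∞} (hε : ε ≠ 0) :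
    ∃ δ : ℝ≥0∞, δ ≠ 0 ∧ ∀ (x₀ : E n) (l : ℝ), 0 < l → ∀ F ⊆ cube x₀ l,
      ε * volume (cube x₀ l) ≤ volume F → δ * wmass w (cube x₀ l) ≤ wmass w F := by
  obtain ⟨C, hC⟩ := h
  have hqq : q.HolderConjugate q.conjExponent := Real.HolderConjugate.conjExponent hq
  set q' := q.conjExponent
  have hq0 : 0 < q := hqq.pos
  have hq'0 : 0 < q' := hqq.symm.pos
  refine ⟨(ε / (C + 1)) ^ q, ?_, fun x₀ l hl F hF hvol => ?_⟩
  · refine (ENNReal.rpow_pos_of_nonneg ?_ hq0.le).ne'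
    exact ENNReal.div_pos hε (by finiteness)
  have hCQ := hC x₀ l hl
  set Q := cube x₀ l
  set V := volume Q with hV
  have hV0 : V ≠ 0 := volume_cube_ne_zero x₀ hl
  have hVt : V ≠ ⊤ := volume_cube_ne_top x₀ hl
  have hA : avg Q (fun x => ENNReal.ofReal (w x)) = V⁻¹ * wmass w Q := rfl
  by_cases hQ0 : wmass w Q = 0
  · simp [hQ0]
  have hwm := hw.aemeasurable
  set D := avg Q fun x => ENNReal.ofReal (w x) ^ (-(q' / q)) with hD
  have hA0 : (V⁻¹ * wmass w Q) ^ (1 / q) ≠ 0 := by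
    refine (ENNReal.rpow_pos_of_nonneg ?_ (by positivity)).ne'
    exact ENNReal.mul_pos (ENNReal.inv_ne_zero.2 hVt) hQ0
  -- As `w(Q) ≠ 0`, the first factor in the `A_q` product is nonzero, so the bound forces the dual
  -- average to be finite; hence `w > 0` almost everywhere on `Q`.
  have hDt : D ≠ ⊤ := by
    intro hDt
    rw [hDt, ENNReal.top_rpow_of_pos (by positivity), hA, ENNReal.mul_top hA0] at hCQ
    simp at hCQ
  have hDint : ∫⁻ x in Q, ENNReal.ofReal (w x) ^ (-(q' / q)) = V * D := by
    rw [hD, avg, ← mul_assoc, ENNReal.mul_inv_cancel hV0 hVt, one_mul]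
  have hpos : ∀ᵐ x ∂volume.restrict Q, ENNReal.ofReal (w x) ≠ 0 := by
    have := ae_lt_top' ((hwm.ennreal_ofReal.pow_const (-(q' / q))).restrict (s := Q))
      (by rw [hDint]; finiteness)
    filter_upwards [this] with x hx h0
    rw [h0, ENNReal.zero_rpow_of_neg (by have : 0 < q' / q := by positivity
                                         linarith)] at hx
    exact lt_irrefl _ hx
  have hHolder : volume F ≤ wmass w F ^ (1 / q) * (V * D) ^ (1 / q') := by
    calc volume F = ∫⁻ _ in F, 1 := by simp
      _ ≤ ∫⁻ x in F, ((fun x => ENNReal.ofReal (w x) ^ (1 / q)) *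
          fun x => ENNReal.ofReal (w x) ^ (-(1 / q))) x := by
        refine lintegral_mono_ae ?_
        filter_upwards [ae_restrict_of_ae_restrict_of_subset hF hpos] with x hx
        rw [Pi.mul_apply, ← ENNReal.rpow_add _ _ hx ENNReal.ofReal_ne_top]
        simp
      _ ≤ (∫⁻ x in F, (ENNReal.ofReal (w x) ^ (1 / q)) ^ q) ^ (1 / q) *
          (∫⁻ x in F, (ENNReal.ofReal (w x) ^ (-(1 / q))) ^ q') ^ (1 / q') :=
        ENNReal.lintegral_mul_le_Lp_mul_Lq _ hqq
          (hwm.ennreal_ofReal.pow_const _).restrict (hwm.ennreal_ofReal.pow_const _).restrict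
      _ ≤ _ := by
        have e1 : ∀ x, (ENNReal.ofReal (w x) ^ (1 / q)) ^ q = ENNReal.ofReal (w x) := fun x => by
          rw [← ENNReal.rpow_mul, one_div_mul_cancel hq0.ne', ENNReal.rpow_one]
        have e2 : ∀ x, (ENNReal.ofReal (w x) ^ (-(1 / q))) ^ q' =
            ENNReal.ofReal (w x) ^ (-(q' / q)) := fun x => by
          rw [← ENNReal.rpow_mul]; congr 1; ring
        simp_rw [e1, e2]
        rw [← hDint]
        gcongr
        rfl
  have hsum : 1 / q + 1 / q' = 1 := by simpa using hqq.inv_add_inv_eq_one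
  have hVV : V = V ^ (1 / q') * V ^ (1 / q) := by
    rw [← ENNReal.rpow_add _ _ hV0 hVt, add_comm, hsum, ENNReal.rpow_one]
  have key : V ^ (1 / q') * (ε * wmass w Q ^ (1 / q)) ≤
      V ^ (1 / q') * (wmass w F ^ (1 / q) * (C + 1)) := by
    calc V ^ (1 / q') * (ε * wmass w Q ^ (1 / q))
        = ε * V * (V⁻¹ * wmass w Q) ^ (1 / q) := by
          rw [ENNReal.mul_rpow_of_nonneg _ _ (by positivity), ENNReal.inv_rpow]
          have : V * (V ^ (1 / q))⁻¹ = V ^ (1 / q') := by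
            nth_rw 1 [hVV]
            rw [mul_assoc, ENNReal.mul_inv_cancel (by simp [hV0, hVt]) (by simp [hV0, hVt]),
              mul_one]
          rw [← this]
          ring
      _ ≤ volume F * (V⁻¹ * wmass w Q) ^ (1 / q) := by gcongr
      _ ≤ wmass w F ^ (1 / q) * (V * D) ^ (1 / q') * (V⁻¹ * wmass w Q) ^ (1 / q) := by gcongr
      _ = V ^ (1 / q') * (wmass w F ^ (1 / q) *
          ((V⁻¹ * wmass w Q) ^ (1 / q) * D ^ (1 / q'))) := by
        rw [ENNReal.mul_rpow_of_nonneg V D (by positivity)]; ring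
      _ ≤ _ := by
        rw [hA] at hCQ
        gcongr
        exact hCQ.trans le_self_add
  have hVq0 : V ^ (1 / q') ≠ 0 := by simp [hV0, hVt]
  have hVqt : V ^ (1 / q') ≠ ⊤ := by simp [hV0, hVt]
  have key2 := (ENNReal.mul_le_mul_iff_right hVq0 hVqt).1 key
  have key3 : ε / (C + 1) * wmass w Q ^ (1 / q) ≤ wmass w F ^ (1 / q) := by
    rw [ENNReal.mul_comm_div, mul_comm, ENNReal.mul_comm_div, ← mul_div_assoc]
    exact ENNReal.div_le_of_le_mul (by rwa [mul_comm])
  have key4 := ENNReal.rpow_le_rpow key3 hq0.le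
  rwa [ENNReal.mul_rpow_of_nonneg _ _ hq0.le, ← ENNReal.rpow_mul, ← ENNReal.rpow_mul,
    one_div_mul_cancel hq0.ne', ENNReal.rpow_one, ENNReal.rpow_one] at key4

/-- A quantitative absolute continuity of `μ` with respect to Lebesgue measure, uniform in the
cubes: a subset of at most half of the volume of a cube carries at most the fraction `β` of its
mass. -/
def HalfSpread (μ : Measure (E n)) (β : ℝ≥0∞) : Prop :=
  ∀ (x₀ : E n) (l : ℝ), 0 < l → ∀ F ⊆ cube x₀ l, MeasurableSet F →
    volume F ≤ volume (cube x₀ l) / 2 → μ F ≤ β * μ (cube x₀ l)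

lemma halfSpread_volume : HalfSpread (volume : Measure (E n)) (1 / 2) := by
  intro x₀ l _ F _ _ h
  rwa [mul_comm, mul_one_div]

/-- The complement of `F` fills at least half of the cube, so it keeps a fraction `δ` of the mass
and `F` gets at most `1 - δ`. -/
lemma MuckenhouptAInfty.exists_halfSpread {w : E n → ℝ} (hw : IsWeight w)
    (h : MuckenhouptAInfty w) : ∃ β < 1, HalfSpread (weightMeasure w) β := by
  obtain ⟨q, hq, h⟩ := h
  obtain ⟨δ, hδ, H⟩ := h.exists_mul_wmass_le hw hq (ε := 1 / 2) (by simp)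
  refine ⟨1 - δ, ENNReal.sub_lt_self (by simp) (by simp) hδ, fun x₀ l hl F hF hFm hvol => ?_⟩
  have hVt := volume_cube_ne_top x₀ hl
  have hwt := hw.wmass_cube_ne_top x₀ hl.le
  have h1 := H x₀ l hl (cube x₀ l \ F) Set.sdiff_subset (by
    rw [measure_sdiff hF hFm.nullMeasurableSet (ne_top_of_le_ne_top hVt (measure_mono hF))]
    refine ENNReal.le_sub_of_add_le_right (ne_top_of_le_ne_top hVt (measure_mono hF)) ?_
    calc 1 / 2 * volume (cube x₀ l) + volume F
        ≤ volume (cube x₀ l) / 2 + volume (cube x₀ l) / 2 := by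
          gcongr
          rw [mul_comm, mul_one_div]
      _ = _ := ENNReal.add_halves _)
  rw [wmass_eq_weightMeasure, wmass_eq_weightMeasure] at h1
  rw [wmass_eq_weightMeasure] at hwt
  have hFt : weightMeasure w F ≠ ⊤ := ne_top_of_le_ne_top hwt (measure_mono hF)
  rw [ENNReal.sub_mul (fun _ _ => hwt), one_mul]
  refine ENNReal.le_sub_of_add_le_left (ne_top_of_le_ne_top hwt (h1.trans
    (measure_mono Set.sdiff_subset))) ?_
  calc _ ≤ weightMeasure w (cube x₀ l \ F) + weightMeasure w F := by gcongr
    _ = _ := by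
      rw [measure_sdiff hF hFm.nullMeasurableSet hFt]
      exact tsub_add_cancel_of_le (measure_mono hF)

/-- The inner cube occupies the fraction `2^{-n}` of its double. -/
lemma MuckenhouptAInfty.exists_doubling {w : E n → ℝ} (hw : IsWeight w)
    (h : MuckenhouptAInfty w) : ∃ C : ℝ≥0, ∀ (x₀ : E n) (l : ℝ), 0 < l →
      wmass w (cube x₀ (2 * l)) ≤ C * wmass w (cube x₀ l) := by
  obtain ⟨q, hq, h⟩ := h
  obtain ⟨δ, hδ, H⟩ := h.exists_mul_wmass_le hw hq (ε := ENNReal.ofReal ((1 / 2) ^ n))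
    (ENNReal.ofReal_pos.2 (by positivity)).ne'
  refine ⟨δ⁻¹.toNNReal, fun x₀ l hl => ?_⟩
  rw [ENNReal.coe_toNNReal (ENNReal.inv_ne_top.2 hδ)]
  have := H x₀ (2 * l) (by positivity) (cube x₀ l) (cube_subset_cube x₀ (by linarith)) (by
    rw [volume_cube _ hl.le, volume_cube _ (by positivity), ← ENNReal.ofReal_mul (by positivity),
      ← mul_pow]
    simp)
  -- Here `δ⁻¹ = 0`, and finiteness of the mass makes `w` vanish on the cube.
  by_cases hδt : δ = ⊤
  · have hw0 : wmass w (cube x₀ (2 * l)) = 0 := by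
      by_contra h0
      rw [hδt, ENNReal.top_mul h0, top_le_iff] at this
      exact hw.wmass_cube_ne_top x₀ hl.le this
    simp [hw0]
  · rw [mul_comm δ⁻¹, ← div_eq_mul_inv,
      ENNReal.le_div_iff_mul_le (Or.inl hδ) (Or.inl hδt), mul_comm]
    exact this

/-- Reverse doubling: `2^{-n} ≤ 1/2` because `n ≥ 1`. Its iterates give the decay that sums the
annuli. -/
lemma HalfSpread.cube_le {μ : Measure (E n)} {β : ℝ≥0∞} (h : HalfSpread μ β) (hn : 0 < n)
    (x₀ : E n) {l : ℝ} (hl : 0 < l) : μ (cube x₀ l) ≤ β * μ (cube x₀ (2 * l)) := by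
  refine h x₀ (2 * l) (by positivity) _ (cube_subset_cube x₀ (by linarith))
    (measurableSet_cube _ _) ?_
  rw [volume_cube _ hl.le, volume_cube _ (by positivity),
    ENNReal.le_div_iff_mul_le (by simp) (by simp), mul_pow]
  rw [mul_comm, ENNReal.ofReal_mul (by positivity)]
  gcongr
  obtain ⟨m, rfl⟩ : ∃ m, n = m + 1 := ⟨n - 1, by omega⟩
  rw [ENNReal.le_ofReal_iff_toReal_le (by simp) (by positivity)]
  have : (1 : ℝ) ≤ 2 ^ m := one_le_pow₀ (by norm_num)
  rw [pow_succ]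
  simp
  linarith

lemma HalfSpread.cube_le_pow {μ : Measure (E n)} {β : ℝ≥0∞} (h : HalfSpread μ β) (hn : 0 < n)
    (x₀ : E n) {l : ℝ} (hl : 0 < l) (j : ℕ) :
    μ (cube x₀ l) ≤ β ^ j * μ (cube x₀ (2 ^ j * l)) := by
  induction j with
  | zero => simp
  | succ j ih =>
    refine ih.trans ?_
    rw [pow_succ, pow_succ, mul_assoc, mul_comm _ (2 : ℝ), mul_assoc]
    gcongr
    exact h.cube_le hn x₀ (by positivity)

variable {𝕜 : Type*} [RCLike 𝕜]

/-! ### Mean values -/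

/-- The mean value `b_Q` over the cube `Q` with centre `x₀` and side `l`. -/
noncomputable def cubeMean (b : E n → 𝕜) (x₀ : E n) (l : ℝ) : 𝕜 := ⨍ y in cube x₀ l, b y

lemma avg_le_bmoNorm (b : E n → 𝕜) (x₀ : E n) {l : ℝ} (hl : 0 < l) :
    avg (cube x₀ l) (fun x => ‖b x - cubeMean b x₀ l‖ₑ) ≤ bmoNorm b :=
  le_iSup_of_le x₀ (le_iSup_of_le l (le_iSup_of_le hl le_rfl))

lemma volume_mul_avg (x₀ : E n) {l : ℝ} (hl : 0 < l) (g : E n → ℝ≥0∞) :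
    volume (cube x₀ l) * avg (cube x₀ l) g = ∫⁻ x in cube x₀ l, g x := by
  rw [avg, ← mul_assoc, ENNReal.mul_inv_cancel (volume_cube_ne_zero x₀ hl)
    (volume_cube_ne_top x₀ hl), one_mul]

lemma setLIntegral_halfCube (x₀ : E n) {l : ℝ} (hl : 0 < l) (g : E n → ℝ≥0∞) :
    ∫⁻ x in halfCube x₀ l, g x = ∫⁻ x in cube x₀ l, g x :=
  setLIntegral_congr (halfCube_ae_eq_cube x₀ hl)

lemma enorm_cubeMean_sub_le {b : E n → 𝕜} (hb : LocallyIntegrable b volume) (x₀ : E n) {l : ℝ}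
    (hl : 0 < l) (c : 𝕜) :
    ‖cubeMean b x₀ l - c‖ₑ ≤ avg (cube x₀ l) fun x => ‖b x - c‖ₑ := by
  have hint := hb.integrableOn_isCompact (isCompact_cube x₀ hl.le)
  have hVt := volume_cube_ne_top x₀ hl
  have hV0 := volume_cube_ne_zero x₀ hl
  have hc : IntegrableOn (fun _ : E n => c) (cube x₀ l) := integrableOn_const hVt
  have : cubeMean b x₀ l - c = (volume.real (cube x₀ l))⁻¹ • ∫ x in cube x₀ l, (b x - c) := by
    rw [integral_sub hint hc, smul_sub, setIntegral_const, smul_smul, inv_mul_cancel₀, one_smul,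
      cubeMean, setAverage_eq]
    exact (ENNReal.toReal_pos hV0 hVt).ne'
  rw [this, enorm_smul, avg]
  gcongr
  · rw [Real.enorm_eq_ofReal (by positivity), measureReal_def,
      ENNReal.ofReal_inv_of_pos (ENNReal.toReal_pos hV0 hVt), ENNReal.ofReal_toReal hVt]
  · exact MeasureTheory.enorm_integral_le_lintegral_enorm _

lemma avg_le_two_pow_mul_avg {x y : E n} {l : ℝ} (hl : 0 < l)
    (h : cube x l ≤ᵐ[volume] cube y (2 * l)) (g : E n → ℝ≥0∞) :
    avg (cube x l) g ≤ 2 ^ n * avg (cube y (2 * l)) g := by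
  have hv : (volume (cube x l))⁻¹ = 2 ^ n * (volume (cube y (2 * l)))⁻¹ := by
    rw [volume_cube _ hl.le, volume_cube _ (by positivity), mul_pow,
      ENNReal.ofReal_mul (by positivity), ENNReal.mul_inv (by simp) (by simp), ← mul_assoc,
      ENNReal.ofReal_pow (by positivity)]
    rw [show ENNReal.ofReal (2 ^ n) = 2 ^ n by
        rw [ENNReal.ofReal_pow zero_le_two, ENNReal.ofReal_ofNat],
      ENNReal.mul_inv_cancel (by simp) (by simp), one_mul]
  rw [avg, avg, hv, mul_assoc]
  exact mul_le_mul_right (mul_le_mul_right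
    (lintegral_mono' (Measure.restrict_mono_ae h) le_rfl) _) _

/-- The inclusion is only almost everywhere so that a dyadic child and its parent, nested as
half-open cubes, are covered. -/
lemma enorm_cubeMean_sub_cubeMean_le {b : E n → 𝕜} (hb : LocallyIntegrable b volume) {x y : E n}
    {l : ℝ} (hl : 0 < l) (h : cube x l ≤ᵐ[volume] cube y (2 * l)) :
    ‖cubeMean b x l - cubeMean b y (2 * l)‖ₑ ≤ 2 ^ n * bmoNorm b := by
  refine (enorm_cubeMean_sub_le hb x hl _).trans ((avg_le_two_pow_mul_avg hl h _).trans ?_)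
  gcongr
  exact avg_le_bmoNorm b y (by positivity)

lemma enorm_cubeMean_sub_cubeMean_pow_le {b : E n → 𝕜} (hb : LocallyIntegrable b volume) (x : E n)
    {l : ℝ} (hl : 0 < l) (j : ℕ) :
    ‖cubeMean b x l - cubeMean b x (2 ^ j * l)‖ₑ ≤ j * (2 ^ n * bmoNorm b) := by
  induction j with
  | zero => simp
  | succ j ih =>
    have h := enorm_cubeMean_sub_cubeMean_le hb (x := x) (y := x) (l := 2 ^ j * l) (by positivity)
      (Filter.Eventually.of_forall
        (cube_subset_cube x (by linarith [show 0 < 2 ^ j * l by positivity])))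
    rw [pow_succ, mul_comm _ (2 : ℝ), mul_assoc]
    calc _ = ‖(cubeMean b x l - cubeMean b x (2 ^ j * l)) +
          (cubeMean b x (2 ^ j * l) - cubeMean b x (2 * (2 ^ j * l)))‖ₑ := by congr 1; ring
      _ ≤ _ := (enorm_add_le _ _).trans (add_le_add ih h)
      _ = _ := by push_cast; ring

/-! ### The John–Nirenberg inequality -/

section Stopping

variable (b : E n → 𝕜) (K : ℝ≥0∞) (c : E n) (l : ℝ)

/-- The points of a cube for which some dyadic subcube has a mean value far from that of the
whole cube. -/
def stoppingSet : Set (E n) :=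
  {x | x ∈ halfCube c l ∧
    ∃ k, K < ‖cubeMean b (dyadicCentre c l x k) (l / 2 ^ k) - cubeMean b c l‖ₑ}

/-- The generation of the stopping cube of a point. -/
noncomputable def stoppingTime (x : E n) : ℕ :=
  sInf {k | K < ‖cubeMean b (dyadicCentre c l x k) (l / 2 ^ k) - cubeMean b c l‖ₑ}

/-- The centre and side length of the stopping cube of a point. -/
noncomputable def stoppingCube (x : E n) : E n × ℝ :=
  (dyadicCentre c l x (stoppingTime b K c l x), l / 2 ^ stoppingTime b K c l x)

variable {b K c l}

lemma lt_enorm_of_mem_stoppingSet {x : E n} (hx : x ∈ stoppingSet b K c l) :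
    K < ‖cubeMean b (stoppingCube b K c l x).1 (stoppingCube b K c l x).2 - cubeMean b c l‖ₑ :=
  Nat.sInf_mem hx.2

lemma mem_stoppingCube {x : E n} (hx : x ∈ stoppingSet b K c l) :
    x ∈ halfCube (stoppingCube b K c l x).1 (stoppingCube b K c l x).2 :=
  mem_halfCube_dyadicCentre hx.1 _

/-- Points of one stopping cube share all ancestors down to it, hence see the same first deviation.
So stopping cubes coincide or are disjoint. -/
lemma stoppingCube_eq (hl : 0 < l) {x y : E n} (hx : x ∈ stoppingSet b K c l)
    (hy : y ∈ halfCube (stoppingCube b K c l x).1 (stoppingCube b K c l x).2) :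
    y ∈ stoppingSet b K c l ∧ stoppingCube b K c l y = stoppingCube b K c l x := by
  have hc := fun j (hj : j ≤ stoppingTime b K c l x) => dyadicCentre_eq hl hy hj
  have hxτ := lt_enorm_of_mem_stoppingSet hx
  have hyS : y ∈ stoppingSet b K c l :=
    ⟨halfCube_dyadicCentre_subset c hl x _ hy, stoppingTime b K c l x, by
      rw [hc _ le_rfl]; exact hxτ⟩
  have h1 : stoppingTime b K c l y ≤ stoppingTime b K c l x :=
    Nat.sInf_le (by rw [Set.mem_ofPred_eq, hc _ le_rfl]; exact hxτ)
  have h2 : stoppingTime b K c l x ≤ stoppingTime b K c l y := by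
    refine Nat.sInf_le ?_
    rw [Set.mem_ofPred_eq, ← hc _ h1]
    exact lt_enorm_of_mem_stoppingSet hyS
  have h3 := le_antisymm h1 h2
  refine ⟨hyS, ?_⟩
  rw [stoppingCube, stoppingCube, h3, hc _ le_rfl]

lemma countable_image_stoppingCube : (stoppingCube b K c l '' stoppingSet b K c l).Countable := by
  refine (Set.countable_iUnion fun k : ℕ =>
    (countable_range_dyadicCentre c l k).image fun d => (d, l / 2 ^ k)).mono ?_
  rintro _ ⟨x, -, rfl⟩
  exact Set.mem_iUnion.2 ⟨stoppingTime b K c l x, _, ⟨x, rfl⟩, rfl⟩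

lemma enorm_stoppingCube_le (hb : LocallyIntegrable b volume) (hl : 0 < l) {x : E n}
    (hx : x ∈ stoppingSet b K c l) :
    ‖cubeMean b (stoppingCube b K c l x).1 (stoppingCube b K c l x).2 - cubeMean b c l‖ₑ ≤
      2 ^ n * bmoNorm b + K := by
  have hlt := lt_enorm_of_mem_stoppingSet hx
  simp only [stoppingCube] at hlt ⊢
  -- Generation `0` is impossible, since the whole cube deviates by `0`. Otherwise the parent
  -- deviates by at most `K`, by minimality, and passing to the child costs `2^n ‖b‖_*`.
  rcases h : stoppingTime b K c l x with _ | k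
  · simp [h, dyadicCentre] at hlt
  · have hk : ‖cubeMean b (dyadicCentre c l x k) (l / 2 ^ k) - cubeMean b c l‖ₑ ≤ K := by
      by_contra! hk
      have : stoppingTime b K c l x ≤ k := Nat.sInf_le hk
      omega
    have hs := halfCube_dyadicCentre_succ_subset c hl x k
    have hlk : 0 < l / 2 ^ k := by positivity
    have h2 : 2 * (l / 2 ^ (k + 1)) = l / 2 ^ k := by rw [div_two_pow_succ]; ring
    have hle := enorm_cubeMean_sub_cubeMean_le hb (x := dyadicCentre c l x (k + 1))
      (y := dyadicCentre c l x k) (l := l / 2 ^ (k + 1)) (by positivity) (by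
        rw [h2]
        exact (halfCube_ae_eq_cube _ (by positivity)).symm.le.trans
          (Filter.EventuallyLE.trans (Filter.Eventually.of_forall hs)
            (halfCube_ae_eq_cube _ (by positivity)).le))
    rw [h2] at hle
    rw [← sub_add_sub_cancel _ (cubeMean b (dyadicCentre c l x k) (l / 2 ^ k))]
    exact (enorm_add_le _ _).trans (add_le_add hle hk)

lemma stoppingSet_eq_biUnion (hl : 0 < l) : stoppingSet b K c l =
    ⋃ i ∈ stoppingCube b K c l '' stoppingSet b K c l, halfCube i.1 i.2 := by
  ext x
  simp only [Set.mem_iUnion, Set.mem_image, exists_prop]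
  constructor
  · exact fun hx => ⟨_, ⟨x, hx, rfl⟩, mem_stoppingCube hx⟩
  · rintro ⟨_, ⟨y, hy, rfl⟩, hx⟩
    exact (stoppingCube_eq hl hy hx).1

lemma pairwiseDisjoint_stoppingCube (hl : 0 < l) :
    (stoppingCube b K c l '' stoppingSet b K c l).PairwiseDisjoint
      fun i => halfCube i.1 i.2 := by
  rintro _ ⟨x, hx, rfl⟩ _ ⟨y, hy, rfl⟩ hne
  refine Set.disjoint_left.2 fun z hzx hzy => hne ?_
  exact (stoppingCube_eq hl hx hzx).2.symm.trans (stoppingCube_eq hl hy hzy).2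

lemma measurableSet_stoppingSet (hl : 0 < l) : MeasurableSet (stoppingSet b K c l) := by
  rw [stoppingSet_eq_biUnion hl]
  exact MeasurableSet.biUnion countable_image_stoppingCube fun i _ => measurableSet_halfCube _ _

lemma stoppingCube_side_pos (hl : 0 < l) (x : E n) : 0 < (stoppingCube b K c l x).2 := by
  simp only [stoppingCube]; positivity

/-- On each stopping cube `K` is less than the average of `|b - b_Q|`; sum over these disjoint
cubes. -/
lemma mul_volume_stoppingSet_le (hb : LocallyIntegrable b volume) (hl : 0 < l) :
    K * volume (stoppingSet b K c l) ≤ bmoNorm b * volume (cube c l) := by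
  have hm := fun (i : E n × ℝ) (_ : i ∈ stoppingCube b K c l '' stoppingSet b K c l) =>
    measurableSet_halfCube i.1 i.2
  calc K * volume (stoppingSet b K c l)
      = ∑' i : stoppingCube b K c l '' stoppingSet b K c l,
          K * volume (halfCube i.1.1 i.1.2) := by
        rw [ENNReal.tsum_mul_left, ← measure_biUnion countable_image_stoppingCube
          (pairwiseDisjoint_stoppingCube hl) hm, ← stoppingSet_eq_biUnion hl]
    _ ≤ ∑' i : stoppingCube b K c l '' stoppingSet b K c l,
          ∫⁻ x in halfCube i.1.1 i.1.2, ‖b x - cubeMean b c l‖ₑ := by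
        refine ENNReal.tsum_le_tsum ?_
        rintro ⟨_, x, hx, rfl⟩
        have hs := stoppingCube_side_pos (b := b) (K := K) (c := c) hl x
        rw [setLIntegral_halfCube _ hs, ← volume_mul_avg _ hs, mul_comm,
          measure_congr (halfCube_ae_eq_cube _ hs)]
        gcongr
        exact (lt_enorm_of_mem_stoppingSet hx).le.trans (enorm_cubeMean_sub_le hb _ hs _)
    _ = ∫⁻ x in stoppingSet b K c l, ‖b x - cubeMean b c l‖ₑ := by
        conv_rhs => rw [stoppingSet_eq_biUnion hl]
        rw [lintegral_biUnion countable_image_stoppingCube hm (pairwiseDisjoint_stoppingCube hl)]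
    _ ≤ ∫⁻ x in cube c l, ‖b x - cubeMean b c l‖ₑ :=
        lintegral_mono_set fun x hx => halfCube_subset_cube c l hx.1
    _ ≤ _ := by
        rw [← volume_mul_avg c hl, mul_comm]
        gcongr
        exact avg_le_bmoNorm b c hl

/-- Off the stopping set all dyadic means around `x` stay within `K` of `b_Q`, and they converge to
`b x`. -/
lemma ae_enorm_le_of_notMem_stoppingSet (hb : LocallyIntegrable b volume) (hl : 0 < l) :
    ∀ᵐ x, x ∈ halfCube c l → x ∉ stoppingSet b K c l → ‖b x - cubeMean b c l‖ₑ ≤ K := by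
  filter_upwards [ae_tendsto_average_cube hb] with x hx hxQ hxS
  have hxS' : ∀ k, ‖cubeMean b (dyadicCentre c l x k) (l / 2 ^ k) - cubeMean b c l‖ₑ ≤ K := by
    intro k
    by_contra! h
    exact hxS ⟨hxQ, k, h⟩
  have h := hx (dyadicCentre c l x) (fun k => l / 2 ^ k) (fun k => by positivity)
    (by simpa [div_eq_mul_inv] using
      (tendsto_pow_atTop_nhds_zero_of_lt_one (r := (1 / 2 : ℝ)) (by norm_num)
        (by norm_num)).const_mul l)
    fun k => halfCube_subset_cube _ _ (mem_halfCube_dyadicCentre hxQ k)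
  exact le_of_tendsto (h.sub_const (cubeMean b c l)).enorm (Filter.Eventually.of_forall hxS')

end Stopping

/-- Up to a null set, a point deviating by more than `(m+1)L` lies in a stopping cube, whose mean is
within `L` of `b_Q`, so it deviates by more than `mL` from that mean. Induction over all cubes
applies there, and each generation costs a factor `β`. -/
theorem HalfSpread.john_nirenberg {μ : Measure (E n)} {β : ℝ≥0∞} (hμ : HalfSpread μ β)
    (hac : μ ≪ volume) {b : E n → 𝕜} (hb : LocallyIntegrable b volume) {B : ℝ≥0} (hB : 0 < B)
    (hbB : bmoNorm b ≤ B) (m : ℕ) (c : E n) {l : ℝ} (hl : 0 < l) :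
    μ {x | x ∈ cube c l ∧ m * (((2 ^ n + 2) * B : ℝ≥0) : ℝ≥0∞) < ‖b x - cubeMean b c l‖ₑ} ≤
      β ^ m * μ (cube c l) := by
  induction m generalizing c l with
  | zero => simpa using measure_mono fun x hx => hx.1
  | succ m ih =>
    -- With this height the stopping set fills at most half of the cube, and `2^n B + K` is the step
    -- of the levels.
    set K : ℝ≥0∞ := 2 * B
    set I := stoppingCube b K c l '' stoppingSet b K c l with hI
    have hIc : I.Countable := countable_image_stoppingCube
    have hK : 2 ^ n * bmoNorm b + K ≤ (((2 ^ n + 2) * B : ℝ≥0) : ℝ≥0∞) := by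
      push_cast
      rw [add_mul]
      gcongr
    set L := (((2 ^ n + 2) * B : ℝ≥0) : ℝ≥0∞) with hL
    have hLt : L ≠ ⊤ := ENNReal.coe_ne_top
    have hae : ∀ᵐ x ∂μ, x ∈ halfCube c l → x ∉ stoppingSet b K c l →
        ‖b x - cubeMean b c l‖ₑ ≤ K := hac (ae_enorm_le_of_notMem_stoppingSet hb hl)
    have hQ : ∀ᵐ x ∂μ, x ∈ cube c l → x ∈ halfCube c l :=
      hac (halfCube_ae_eq_cube c hl).symm.le
    have hvol : volume (stoppingSet b K c l) ≤ volume (cube c l) / 2 := by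
      have h := (mul_volume_stoppingSet_le (K := K) hb hl (c := c)).trans
        (mul_le_mul_left hbB _)
      rw [ENNReal.le_div_iff_mul_le (by simp) (by simp)]
      rw [show K * volume (stoppingSet b K c l) = B * (volume (stoppingSet b K c l) * 2) by
        simp only [K]; ring] at h
      exact (ENNReal.mul_le_mul_iff_right (by exact_mod_cast hB.ne') (by simp)).1 h
    calc μ {x | x ∈ cube c l ∧ ((m + 1 : ℕ) : ℝ≥0∞) * L < ‖b x - cubeMean b c l‖ₑ}
        ≤ μ (⋃ i ∈ I, {x | x ∈ cube i.1 i.2 ∧ m * L < ‖b x - cubeMean b i.1 i.2‖ₑ}) := by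
          refine measure_mono_ae ?_
          filter_upwards [hae, hQ] with x h1 h2 ⟨hx, hxm⟩
          have hxS : x ∈ stoppingSet b K c l := by
            by_contra hxS
            refine (h1 (h2 hx) hxS).not_gt (lt_of_le_of_lt ?_ hxm)
            push_cast
            rw [add_mul, one_mul]
            exact (le_add_self.trans hK).trans le_add_self
          refine Set.mem_biUnion (Set.mem_image_of_mem _ hxS)
            ⟨halfCube_subset_cube _ _ (mem_stoppingCube hxS), ?_⟩
          set d := cubeMean b (stoppingCube b K c l x).1 (stoppingCube b K c l x).2
          have h3 : ‖d - cubeMean b c l‖ₑ ≤ L := (enorm_stoppingCube_le hb hl hxS).trans hK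
          have h4 : ‖b x - cubeMean b c l‖ₑ ≤ ‖b x - d‖ₑ + L := by
            rw [← sub_add_sub_cancel _ d]
            exact (enorm_add_le _ _).trans (by gcongr)
          have h5 := hxm.trans_le h4
          push_cast at h5
          rw [add_mul, one_mul] at h5
          exact lt_of_add_lt_add_right h5
      _ ≤ ∑' i : I, μ {x | x ∈ cube i.1.1 i.1.2 ∧ m * L < ‖b x - cubeMean b i.1.1 i.1.2‖ₑ} :=
          measure_biUnion_le μ hIc _
      _ ≤ ∑' i : I, β ^ m * μ (halfCube i.1.1 i.1.2) := by
          refine ENNReal.tsum_le_tsum ?_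
          rintro ⟨_, x, hx, rfl⟩
          have hs := stoppingCube_side_pos (b := b) (K := K) (c := c) hl x
          rw [measure_congr (hac (halfCube_ae_eq_cube _ hs))]
          exact ih _ hs
      _ = β ^ m * μ (stoppingSet b K c l) := by
          rw [ENNReal.tsum_mul_left, ← measure_biUnion hIc (pairwiseDisjoint_stoppingCube hl)
            (fun i _ => measurableSet_halfCube i.1 i.2), ← stoppingSet_eq_biUnion hl]
      _ ≤ β ^ m * (β * μ (cube c l)) := by
          gcongr
          exact hμ c l hl _ (fun x hx => halfCube_subset_cube c l hx.1)
            (measurableSet_stoppingSet hl) hvol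
      _ = _ := by ring

/-- A discrete layer-cake bound: for `s > 0` the single term `m = ⌈s / L⌉ - 1` already dominates,
and the summand `1` serves `s = 0`. -/
lemma exp_le_one_add_tsum {ρ L : ℝ} (hρ : 1 < ρ) (hL : 0 < L) {s : ℝ} (hs : 0 ≤ s) :
    ENNReal.ofReal (Real.exp (Real.log ρ / L * s)) ≤
      1 + ∑' m : ℕ, (if m * L < s then ENNReal.ofReal ρ ^ (m + 1) else 0) := by
  have hlog := Real.log_pos hρ
  rcases hs.eq_or_lt with rfl | hs
  · simp
  · set N := ⌈s / L⌉₊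
    obtain ⟨m, hm⟩ : ∃ m, N = m + 1 := ⟨N - 1, by have := Nat.ceil_pos.2 (div_pos hs hL); omega⟩
    have h1 : s / L ≤ m + 1 := by
      have := Nat.le_ceil (s / L)
      rw [show ⌈s / L⌉₊ = m + 1 from hm] at this
      exact_mod_cast this
    have h2 : m * L < s := by
      rw [← lt_div_iff₀ hL]
      exact Nat.lt_ceil.1 (by omega)
    refine (le_trans ?_ (ENNReal.le_tsum m)).trans le_add_self
    rw [if_pos h2, ← ENNReal.ofReal_pow (by linarith)]
    refine ENNReal.ofReal_le_ofReal ?_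
    conv_rhs => rw [← Real.exp_log (show 0 < ρ by linarith), ← Real.exp_nat_mul]
    refine Real.exp_le_exp.2 ?_
    calc Real.log ρ / L * s = s / L * Real.log ρ := by ring
      _ ≤ _ := by push_cast; gcongr

theorem HalfSpread.exists_lintegral_exp_le {μ : Measure (E n)} {β : ℝ≥0∞} (hμ : HalfSpread μ β)
    (hβ : β < 1) (hac : μ ≪ volume) {b : E n → 𝕜} (hb : MemBMO b) :
    ∃ θ : ℝ, 0 < θ ∧ ∃ C : ℝ≥0, ∀ (c : E n) (l : ℝ), 0 < l →
      ∫⁻ x in cube c l, ENNReal.ofReal (Real.exp (θ * ‖b x - cubeMean b c l‖)) ∂μ ≤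
        C * μ (cube c l) := by
  -- The base `r⁻¹ > 1` of the exponential is chosen with `r⁻¹ β < 1`, so that the layers form a
  -- convergent geometric series with sum `G`.
  obtain ⟨r, hβr, hr⟩ := ENNReal.lt_iff_exists_nnreal_btwn.1 hβ
  have hr0 : 0 < r := by exact_mod_cast (zero_le (a := β)).trans_lt hβr
  have hr1 : r < 1 := by exact_mod_cast hr
  set B : ℝ≥0 := (bmoNorm b).toNNReal + 1
  have hbB : bmoNorm b ≤ B := by
    simp only [B, ENNReal.coe_add, ENNReal.coe_toNNReal hb.norm_lt_top.ne]
    exact le_self_add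
  set L : ℝ≥0 := (2 ^ n + 2) * B with hL
  have hB0 : 0 < B := by positivity
  have hL0 : 0 < L := by positivity
  have hρ : (1 : ℝ) < (r : ℝ)⁻¹ := (one_lt_inv₀ (by exact_mod_cast hr0)).2 (by exact_mod_cast hr1)
  have hρr : ENNReal.ofReal (r : ℝ)⁻¹ = (r : ℝ≥0∞)⁻¹ := by
    rw [ENNReal.ofReal_inv_of_pos (by exact_mod_cast hr0), ENNReal.ofReal_coe_nnreal]
  have hrβ : (r : ℝ≥0∞)⁻¹ * β < 1 := by
    rw [mul_comm, ← div_eq_mul_inv]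
    exact ENNReal.div_lt_of_lt_mul (by simpa using hβr)
  set G : ℝ≥0∞ := 1 + (r : ℝ≥0∞)⁻¹ * (1 - (r : ℝ≥0∞)⁻¹ * β)⁻¹
  have hr0' : (r : ℝ≥0∞) ≠ 0 := by exact_mod_cast hr0.ne'
  have hG : G ≠ ⊤ := ENNReal.add_ne_top.2 ⟨by simp, ENNReal.mul_ne_top (by simp [hr0.ne'])
    (ENNReal.inv_ne_top.2 (tsub_pos_of_lt hrβ).ne')⟩
  refine ⟨Real.log (r : ℝ)⁻¹ / L, div_pos (Real.log_pos hρ) (by exact_mod_cast hL0),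
    G.toNNReal, fun c l hl => ?_⟩
  rw [ENNReal.coe_toNNReal hG]
  have hbm : AEStronglyMeasurable b μ := hb.locallyIntegrable.aestronglyMeasurable.mono_ac hac
  have hS : ∀ m : ℕ, NullMeasurableSet {x | m * (L : ℝ) < ‖b x - cubeMean b c l‖} μ := fun m =>
    nullMeasurableSet_lt aemeasurable_const (hbm.sub aestronglyMeasurable_const).norm.aemeasurable
  calc _ ≤ ∫⁻ x in cube c l, (1 + ∑' m : ℕ, {x | m * (L : ℝ) < ‖b x - cubeMean b c l‖}.indicator
          (fun _ => (r : ℝ≥0∞)⁻¹ ^ (m + 1)) x) ∂μ := by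
        refine lintegral_mono fun x => ?_
        refine (exp_le_one_add_tsum hρ (by exact_mod_cast hL0) (norm_nonneg _)).trans_eq ?_
        simp only [Set.indicator, Set.mem_ofPred_eq, hρr]
    _ = μ (cube c l) + ∑' m : ℕ, (r : ℝ≥0∞)⁻¹ ^ (m + 1) *
          μ {x | x ∈ cube c l ∧ m * (L : ℝ≥0∞) < ‖b x - cubeMean b c l‖ₑ} := by
        rw [lintegral_add_left measurable_const, lintegral_tsum fun m =>
          (aemeasurable_const.indicator₀
            ((hS m).mono_ac Measure.restrict_le_self.absolutelyContinuous))]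
        congr 1
        · simp
        · congr 1 with m
          rw [lintegral_indicator_const₀
            ((hS m).mono_ac Measure.restrict_le_self.absolutelyContinuous),
            Measure.restrict_apply' (measurableSet_cube c l)]
          congr 2
          ext x
          have : (m * (L : ℝ) < ‖b x - cubeMean b c l‖) ↔
              m * (L : ℝ≥0∞) < ‖b x - cubeMean b c l‖ₑ := by
            rw [← ofReal_norm, ENNReal.lt_ofReal_iff_toReal_lt (by finiteness)]
            simp
          simp [this, and_comm]
    _ ≤ μ (cube c l) + ∑' m : ℕ, (r : ℝ≥0∞)⁻¹ ^ (m + 1) * (β ^ m * μ (cube c l)) := by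
        gcongr with m
        exact hμ.john_nirenberg hac hb.locallyIntegrable hB0 hbB m c hl
    _ = G * μ (cube c l) := by
        simp only [G]
        rw [← ENNReal.tsum_geometric, ← ENNReal.tsum_mul_left, add_mul, one_mul,
          ← ENNReal.tsum_mul_right]
        congr 2 with m
        rw [mul_pow]; ring

/-! ### The generalized Hölder inequality -/

lemma youngLog_nonneg {a u : ℝ} (hu : 0 ≤ u) : 0 ≤ youngLog a u := by
  have : 0 ≤ Real.log (Real.exp 1 + u) :=
    Real.log_nonneg (by linarith [Real.one_le_exp (zero_le_one (α := ℝ))])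
  unfold youngLog
  positivity

/-- Young's inequality for `t ↦ t ^ a * log (e + t) ^ a` and an exponential. -/
lemma exists_rpow_le_youngLog_add_exp {a θ : ℝ} (ha : 0 < a) (hθ : 0 < θ) :
    ∃ C : ℝ, 0 < C ∧ ∀ s u : ℝ, 0 ≤ s → 0 ≤ u →
      ((1 + s) * u) ^ a ≤ C * (youngLog a u + Real.exp (θ * s)) := by
  -- If `1 + s ≤ M log (e + u)`, the Young function dominates. Otherwise `u` and `(1 + s) / M` are
  -- both at most `exp ((1 + s) / M)`, and this `M` turns the product into `M^a exp (θ (1 + s))`.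
  set M := 2 * a / θ with hM
  have hM0 : 0 < M := by positivity
  have hMa : 0 < M ^ a := by positivity
  refine ⟨M ^ a * (1 + Real.exp θ), by positivity, fun s u hs hu => ?_⟩
  have hy := youngLog_nonneg (a := a) hu
  have he : 0 < Real.exp 1 + u := by positivity
  rcases le_or_gt (1 + s) (M * Real.log (Real.exp 1 + u)) with h | h
  · have hlog : 0 ≤ Real.log (Real.exp 1 + u) :=
      Real.log_nonneg (by linarith [Real.one_le_exp (zero_le_one (α := ℝ))])
    calc ((1 + s) * u) ^ a ≤ (M * Real.log (Real.exp 1 + u) * u) ^ a := by gcongr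
      _ = M ^ a * youngLog a u := by
        rw [Real.mul_rpow (by positivity) hu, Real.mul_rpow hM0.le hlog, youngLog]; ring
      _ ≤ M ^ a * (1 + Real.exp θ) * (youngLog a u + Real.exp (θ * s)) := by
        have : 0 ≤ Real.exp θ * youngLog a u := by positivity
        have h2 : 0 ≤ (1 + Real.exp θ) * Real.exp (θ * s) := by positivity
        rw [mul_assoc]
        gcongr
        linarith
  · set v := (1 + s) / M with hv
    have h1 : u ≤ Real.exp v := by
      have : Real.log (Real.exp 1 + u) < v := by rw [hv, lt_div_iff₀ hM0]; linarith
      have := (Real.log_lt_iff_lt_exp he).1 this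
      linarith [Real.exp_pos 1]
    have h2 : 1 + s ≤ M * Real.exp v := by
      have : v ≤ Real.exp v := by linarith [Real.add_one_le_exp v]
      rw [hv, div_le_iff₀ hM0] at this
      rw [mul_comm]; exact this
    calc ((1 + s) * u) ^ a ≤ (M * Real.exp v * Real.exp v) ^ a := by gcongr
      _ = M ^ a * (Real.exp θ * Real.exp (θ * s)) := by
        rw [mul_assoc, Real.mul_rpow hM0.le (by positivity), ← Real.exp_add, ← Real.exp_mul,
          ← Real.exp_add]
        congr 2
        rw [hv, hM]; field_simp; ring
      _ ≤ M ^ a * (1 + Real.exp θ) * (youngLog a u + Real.exp (θ * s)) := by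
        have : 0 ≤ Real.exp θ * youngLog a u := by positivity
        have h2 : 0 < Real.exp (θ * s) := by positivity
        rw [mul_assoc]
        gcongr
        · linarith
        · linarith

lemma measurable_youngExt_youngLog (a : ℝ) : Measurable (youngExt (youngLog a)) := by
  unfold youngExt youngLog
  refine Measurable.ite (measurableSet_singleton ⊤) measurable_const ?_
  fun_prop

/-- Hölder's inequality for `|f| ν^{1/p}` and `(1 + |b - b_Q|) ν^{-1/p}`. Young's inequality with `u
= ν^{-1/p} / t` splits the `p'`-th power of the latter into the Young function, of average at most
`1`, and an exponential that John–Nirenberg integrates. -/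
lemma MemBMO.exists_avg_le {b : E n → 𝕜} (hb : MemBMO b) {p : ℝ} (hp : 1 < p) :
    ∃ C : ℝ≥0, ∀ (ν : E n → ℝ) (f : E n → 𝕜), AEMeasurable ν volume →
      AEStronglyMeasurable f volume → ∀ (c : E n) (l : ℝ), 0 < l → ∀ t : ℝ≥0, 0 < t →
      avg (cube c l) (fun x => youngExt (youngLog p.conjExponent)
        (ENNReal.ofReal (ν x) ^ (-(1 / p)) / t)) ≤ 1 →
      avg (cube c l) (fun x => (1 + ‖b x - cubeMean b c l‖ₑ) * ‖f x‖ₑ) ≤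
        C * t * ((volume (cube c l))⁻¹ * wpow p ν f (cube c l)) ^ (1 / p) := by
  have hpp : p.HolderConjugate p.conjExponent := Real.HolderConjugate.conjExponent hp
  set p' := p.conjExponent
  have hp0 : 0 < p := hpp.pos
  have hp'0 : 0 < p' := hpp.symm.pos
  obtain ⟨θ, hθ, C₁, hC₁⟩ := halfSpread_volume.exists_lintegral_exp_le (n := n)
    (by rw [one_div]; exact ENNReal.inv_lt_one.2 ENNReal.one_lt_two)
    Measure.AbsolutelyContinuous.rfl hb
  obtain ⟨C₀, hC₀, hY⟩ := exists_rpow_le_youngLog_add_exp hp'0 hθ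
  set D : ℝ≥0∞ := ENNReal.ofReal C₀ * (1 + C₁) with hD
  have hDt : D ^ (1 / p') ≠ ⊤ := by finiteness
  refine ⟨(D ^ (1 / p')).toNNReal, fun ν f hν hf c l hl t ht hlux => ?_⟩
  rw [ENNReal.coe_toNNReal hDt]
  set Q := cube c l
  set V := volume Q with hV
  have hV0 : V ≠ 0 := volume_cube_ne_zero c hl
  have hVt : V ≠ ⊤ := volume_cube_ne_top c hl
  set m := cubeMean b c l
  set h : E n → ℝ≥0∞ := fun x => ENNReal.ofReal (ν x) ^ (-(1 / p)) with hh
  have hhm : AEMeasurable h volume := hν.ennreal_ofReal.pow_const _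
  have ht0 : (t : ℝ≥0∞) ≠ 0 := by exact_mod_cast ht.ne'
  have hYint : ∫⁻ x in Q, youngExt (youngLog p') (h x / t) ≤ V := by
    rw [← volume_mul_avg c hl]
    exact (mul_le_mul_right hlux _).trans_eq (mul_one _)
  have hYm : AEMeasurable (fun x => youngExt (youngLog p') (h x / t)) volume :=
    (measurable_youngExt_youngLog p').comp_aemeasurable (hhm.div_const _)
  -- Admissibility of `t` forces `ν > 0` almost everywhere on `Q`, so `ν^{1/p} ν^{-1/p} = 1` may be
  -- inserted.
  have hfin : ∀ᵐ x ∂volume.restrict Q, h x ≠ ⊤ := by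
    filter_upwards [ae_lt_top' hYm.restrict (ne_top_of_le_ne_top hVt hYint)] with x hx htop
    rw [htop, ENNReal.top_div_of_ne_top (by simp)] at hx
    simp [youngExt] at hx
  have hbm : AEMeasurable (fun x => 1 + ‖b x - m‖ₑ) volume :=
    (hb.locallyIntegrable.aestronglyMeasurable.sub aestronglyMeasurable_const).enorm.const_add 1
  have hpt : ∀ᵐ x ∂volume.restrict Q, ((1 + ‖b x - m‖ₑ) * h x) ^ p' ≤
      (t : ℝ≥0∞) ^ p' * (ENNReal.ofReal C₀ * (youngExt (youngLog p') (h x / t) +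
        ENNReal.ofReal (Real.exp (θ * ‖b x - m‖)))) := by
    filter_upwards [hfin] with x hx
    set u := h x / t with hu
    have hut : u ≠ ⊤ := by finiteness
    have e1 : h x = t * u := by
      rw [hu, ENNReal.mul_div_cancel ht0 ENNReal.coe_ne_top]
    rw [e1, mul_left_comm, ENNReal.mul_rpow_of_nonneg _ _ hp'0.le]
    gcongr
    rw [youngExt, if_neg hut, ← ENNReal.ofReal_add (youngLog_nonneg ENNReal.toReal_nonneg)
      (Real.exp_pos _).le, ← ENNReal.ofReal_mul hC₀.le]
    refine le_trans ?_ (ENNReal.ofReal_le_ofReal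
      (hY ‖b x - m‖ u.toReal (norm_nonneg _) ENNReal.toReal_nonneg))
    rw [← ENNReal.ofReal_rpow_of_nonneg (by positivity) hp'0.le,
      ENNReal.ofReal_mul (by positivity), ENNReal.ofReal_add zero_le_one (norm_nonneg _),
      ENNReal.ofReal_toReal hut, ENNReal.ofReal_one, ofReal_norm]
  have hG : ∫⁻ x in Q, ((1 + ‖b x - m‖ₑ) * h x) ^ p' ≤ (t : ℝ≥0∞) ^ p' * (D * V) := by
    refine (lintegral_mono_ae hpt).trans ?_
    rw [lintegral_const_mul' _ _ (by finiteness), lintegral_const_mul' _ _ (by finiteness),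
      lintegral_add_left' hYm.restrict, hD, mul_assoc]
    gcongr
    rw [add_mul, one_mul]
    exact add_le_add hYint (hC₁ c l hl)
  have hmain : ∫⁻ x in Q, (1 + ‖b x - m‖ₑ) * ‖f x‖ₑ ≤
      wpow p ν f Q ^ (1 / p) * ((t : ℝ≥0∞) ^ p' * (D * V)) ^ (1 / p') := by
    calc ∫⁻ x in Q, (1 + ‖b x - m‖ₑ) * ‖f x‖ₑ
        ≤ ∫⁻ x in Q, ((fun x => ‖f x‖ₑ * ENNReal.ofReal (ν x) ^ (1 / p)) *
            fun x => (1 + ‖b x - m‖ₑ) * h x) x := by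
          refine lintegral_mono_ae ?_
          filter_upwards [hfin] with x hx
          have hν0 : ENNReal.ofReal (ν x) ≠ 0 := by
            intro h0
            simp [hh, h0, hp0] at hx
          have : ENNReal.ofReal (ν x) ^ (1 / p) * h x = 1 := by
            rw [hh, ← ENNReal.rpow_add _ _ hν0 ENNReal.ofReal_ne_top]; simp
          rw [Pi.mul_apply]
          refine le_of_eq ?_
          calc (1 + ‖b x - m‖ₑ) * ‖f x‖ₑ
              = (1 + ‖b x - m‖ₑ) * ‖f x‖ₑ * (ENNReal.ofReal (ν x) ^ (1 / p) * h x) := by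
                rw [this, mul_one]
            _ = _ := by ring
      _ ≤ (∫⁻ x in Q, (‖f x‖ₑ * ENNReal.ofReal (ν x) ^ (1 / p)) ^ p) ^ (1 / p) *
          (∫⁻ x in Q, ((1 + ‖b x - m‖ₑ) * h x) ^ p') ^ (1 / p') :=
        ENNReal.lintegral_mul_le_Lp_mul_Lq _ hpp
          (hf.enorm.mul (hν.ennreal_ofReal.pow_const _)).restrict (hbm.mul hhm).restrict
      _ ≤ _ := by
        gcongr
        refine (lintegral_congr fun x => ?_).le
        rw [ENNReal.mul_rpow_of_nonneg _ _ hp0.le, ← ENNReal.rpow_mul,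
          one_div_mul_cancel hp0.ne', ENNReal.rpow_one]
  have hVV : V⁻¹ * V ^ (1 / p') = V⁻¹ ^ (1 / p) := by
    rw [ENNReal.inv_rpow, ← ENNReal.rpow_neg_one, ← ENNReal.rpow_add _ _ hV0 hVt,
      ← ENNReal.rpow_neg]
    congr 1
    have : 1 / p + 1 / p' = 1 := by simpa using hpp.inv_add_inv_eq_one
    linarith
  calc V⁻¹ * ∫⁻ x in Q, (1 + ‖b x - m‖ₑ) * ‖f x‖ₑ
      ≤ V⁻¹ * (wpow p ν f Q ^ (1 / p) * ((t : ℝ≥0∞) ^ p' * (D * V)) ^ (1 / p')) := by gcongr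
    _ = D ^ (1 / p') * t * (V⁻¹ * wpow p ν f Q) ^ (1 / p) := by
      rw [ENNReal.mul_rpow_of_nonneg V⁻¹ _ (by positivity), ← hVV,
        ENNReal.mul_rpow_of_nonneg _ _ (by positivity),
        ENNReal.mul_rpow_of_nonneg D _ (by positivity), ← ENNReal.rpow_mul,
        mul_one_div_cancel hp'0.ne', ENNReal.rpow_one]
      ring

lemma avg_rpow_le {Q : Set (E n)} (hQ0 : volume Q ≠ 0) (hQt : volume Q ≠ ⊤) {g : E n → ℝ≥0∞}
    (hg : AEMeasurable g volume) {r : ℝ} (hr : 1 < r) :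
    avg Q g ≤ (avg Q fun x => g x ^ r) ^ (1 / r) := by
  have hrr : r.HolderConjugate r.conjExponent := Real.HolderConjugate.conjExponent hr
  have h := ENNReal.lintegral_mul_le_Lp_mul_Lq (volume.restrict Q) hrr hg.restrict
    (aemeasurable_const (b := (1 : ℝ≥0∞)))
  simp only [Pi.mul_apply, mul_one, ENNReal.one_rpow, lintegral_one,
    Measure.restrict_apply_univ] at h
  have hr0 : 0 < r := by linarith
  rw [avg, avg, ENNReal.mul_rpow_of_nonneg _ _ (by positivity)]
  calc _ ≤ (volume Q)⁻¹ * ((∫⁻ x in Q, g x ^ r) ^ (1 / r) * volume Q ^ (1 / r.conjExponent)) := by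
        gcongr
    _ = (volume Q)⁻¹ * volume Q ^ (1 / r.conjExponent) * (∫⁻ x in Q, g x ^ r) ^ (1 / r) := by ring
    _ = _ := by
      congr 1
      rw [ENNReal.inv_rpow, ← ENNReal.rpow_neg_one, ← ENNReal.rpow_add _ _ hQ0 hQt,
        ← ENNReal.rpow_neg]
      congr 1
      have : 1 / r + 1 / r.conjExponent = 1 := by simpa using hrr.inv_add_inv_eq_one
      linarith

lemma wpow_rpow_le_morreyNorm {p κ : ℝ} (hp : 0 < p) {ν w : E n → ℝ} (hw : IsWeight w)
    (f : E n → 𝕜) (c : E n) {l : ℝ} (hl : 0 < l) (h0 : wmass w (cube c l) ≠ 0) :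
    wpow p ν f (cube c l) ^ (1 / p) ≤
      morreyNorm p κ ν w f * wmass w (cube c l) ^ (κ / p) := by
  have hwt := hw.wmass_cube_ne_top c hl.le
  have h : ((wmass w (cube c l) ^ κ)⁻¹ * wpow p ν f (cube c l)) ^ (1 / p) ≤
      morreyNorm p κ ν w f := le_iSup_of_le c (le_iSup_of_le l (le_iSup_of_le hl le_rfl))
  rw [ENNReal.mul_rpow_of_nonneg _ _ (by positivity), ENNReal.inv_rpow, ← ENNReal.rpow_mul,
    mul_one_div, mul_comm, ← div_eq_mul_inv] at h
  exact (ENNReal.div_le_iff (ENNReal.rpow_pos (pos_iff_ne_zero.2 h0) hwt).ne'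
    (ENNReal.rpow_ne_top_of_ne_zero h0 hwt)).1 h

/-- The `L^r` average of `w` dominates its mean, so the Luxemburg average is at most `C (|Q| /
w(Q))^{1/p}`. The powers of `|Q|` cancel, and the Morrey norm supplies `w(Q)^{κ/p}`. -/
theorem BumpCondition.exists_avg_le {p κ : ℝ} (hp : 1 < p) {w ν : E n → ℝ} (hw : IsWeight w)
    (hν : IsWeight ν) {b : E n → 𝕜} (hb : MemBMO b) (h : BumpCondition p w ν) :
    ∃ C : ℝ≥0, ∀ (f : E n → 𝕜), AEStronglyMeasurable f volume → ∀ (c : E n) (l : ℝ), 0 < l →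
      wmass w (cube c l) ≠ 0 →
      avg (cube c l) (fun x => (1 + ‖b x - cubeMean b c l‖ₑ) * ‖f x‖ₑ) ≤
        C * morreyNorm p κ ν w f * wmass w (cube c l) ^ ((κ - 1) / p) := by
  obtain ⟨r, hr, C, hC⟩ := h
  obtain ⟨C₂, hC₂⟩ := hb.exists_avg_le hp
  refine ⟨C₂ * (C + 1), fun f hf c l hl h0 => ?_⟩
  have hp0 : 0 < p := by linarith
  have hr0 : 0 < r := by linarith
  set Q := cube c l
  set V := volume Q with hV
  have hV0 : V ≠ 0 := volume_cube_ne_zero c hl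
  have hVt : V ≠ ⊤ := volume_cube_ne_top c hl
  set W := wmass w Q with hW
  have hWt : W ≠ ⊤ := hw.wmass_cube_ne_top c hl.le
  set Y := (V⁻¹ * W) ^ (1 / p) with hY
  have hVW0 : V⁻¹ * W ≠ 0 := mul_ne_zero (ENNReal.inv_ne_zero.2 hVt) h0
  have hVWt : V⁻¹ * W ≠ ⊤ := by finiteness
  have hY0 : Y ≠ 0 := (ENNReal.rpow_pos (pos_iff_ne_zero.2 hVW0) hVWt).ne'
  have hYt : Y ≠ ⊤ := ENNReal.rpow_ne_top_of_ne_zero hVW0 hVWt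
  set lux := luxemburg (youngLog p.conjExponent) Q fun x => ENNReal.ofReal (ν x) ^ (-(1 / p))
    with hlux
  have hYlux : Y * lux ≤ C := by
    refine le_trans ?_ (hC c l hl)
    gcongr
    rw [hY, show 1 / (r * p) = 1 / r * (1 / p) by field_simp, ENNReal.rpow_mul]
    gcongr
    exact avg_rpow_le hV0 hVt hw.aemeasurable.ennreal_ofReal hr
  -- The infimum need not be attained; enlarging `C` to `C + 1` leaves room for an admissible `t`.
  have hlt : lux < (C + 1) / Y := by
    refine lt_of_le_of_lt (b := C / Y) ?_ ?_
    · rw [ENNReal.le_div_iff_mul_le (Or.inl hY0) (Or.inl hYt), mul_comm]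
      exact hYlux
    · rw [ENNReal.div_lt_iff (Or.inl hY0) (Or.inl hYt), ENNReal.div_mul_cancel hY0 hYt]
      exact ENNReal.lt_add_right (by simp) one_ne_zero
  rw [hlux, luxemburg] at hlt
  obtain ⟨t, ht⟩ := iInf_lt_iff.1 hlt
  obtain ⟨⟨ht0, hta⟩, htlt⟩ := iInf_lt_iff.1 ht
  refine (hC₂ ν f hν.aemeasurable hf c l hl t ht0 hta).trans ?_
  rw [ENNReal.mul_rpow_of_nonneg _ _ (by positivity)]
  have hf' := wpow_rpow_le_morreyNorm (κ := κ) hp0 hw (ν := ν) f c hl h0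
  have hvy : Y⁻¹ * V⁻¹ ^ (1 / p) = W ^ (-(1 / p)) := by
    have hVp0 : V⁻¹ ^ (1 / p) ≠ 0 :=
      (ENNReal.rpow_pos (pos_iff_ne_zero.2 (ENNReal.inv_ne_zero.2 hVt)) (by simpa)).ne'
    have hVpt : V⁻¹ ^ (1 / p) ≠ ⊤ := by finiteness
    rw [hY, ENNReal.mul_rpow_of_nonneg _ _ (by positivity), ENNReal.mul_inv (Or.inl hVp0)
      (Or.inl hVpt), mul_right_comm, ENNReal.inv_mul_cancel hVp0 hVpt, one_mul, ENNReal.rpow_neg]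
  calc (C₂ : ℝ≥0∞) * t * (V⁻¹ ^ (1 / p) * wpow p ν f Q ^ (1 / p))
      ≤ C₂ * ((C + 1) / Y) * (V⁻¹ ^ (1 / p) * (morreyNorm p κ ν w f * W ^ (κ / p))) := by
        gcongr
    _ = C₂ * (C + 1) * morreyNorm p κ ν w f * ((Y⁻¹ * V⁻¹ ^ (1 / p)) * W ^ (κ / p)) := by
        rw [div_eq_mul_inv]; ring
    _ = _ := by
        rw [hvy, ← ENNReal.rpow_add _ _ h0 hWt]
        push_cast
        congr 2
        ring

/-! ### The part of a function away from a cube -/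

/-- Some coordinate of `x - y` is at least `(2^{j+1} - 1) l / 2 ≥ 2^{j+2} l / 8`. -/
lemma inv_enorm_sub_pow_le {c x y : E n} {l : ℝ} (hl : 0 < l) (hx : x ∈ cube c l) {j : ℕ}
    (hy : y ∉ cube c (2 ^ (j + 1) * l)) :
    (‖x - y‖ₑ ^ n)⁻¹ ≤ 8 ^ n * (volume (cube c (2 ^ (j + 2) * l)))⁻¹ := by
  have hd : 2 ^ (j + 2) * l / 8 ≤ ‖x - y‖ := by
    simp only [cube, Set.mem_ofPred_eq, not_forall, not_le] at hy
    obtain ⟨i, hi⟩ := hy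
    have h1 : |x i - y i| ≤ ‖x - y‖ := by simpa using PiLp.norm_apply_le (x - y) i
    have h2 := hx i
    have h3 : |y i - c i| ≤ |x i - y i| + |x i - c i| := by
      rw [abs_sub_comm (x i) (y i)]; exact abs_sub_le _ _ _
    have h4 : (1 : ℝ) ≤ 2 ^ j := one_le_pow₀ (by norm_num)
    rw [pow_succ] at hi
    rw [pow_add]
    nlinarith
  have h8 : ENNReal.ofReal (2 ^ (j + 2) * l) ^ n / 8 ^ n ≤ ‖x - y‖ₑ ^ n := by
    rw [div_eq_mul_inv, ENNReal.inv_pow, ← mul_pow, ← div_eq_mul_inv, ← ofReal_norm,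
      show (8 : ℝ≥0∞) = ENNReal.ofReal 8 by simp,
      ← ENNReal.ofReal_div_of_pos (by norm_num)]
    gcongr
  rw [volume_cube _ (by positivity), ENNReal.ofReal_pow (by positivity)]
  refine (ENNReal.inv_le_inv.2 h8).trans_eq ?_
  rw [ENNReal.inv_div (by simp) (by simp), div_eq_mul_inv]

lemma tsum_one_add_mul_geometric_ne_top (D : ℝ≥0) {γ : ℝ≥0∞} (hγ : γ < 1) :
    ∑' j : ℕ, (1 + ((j + 2 : ℕ) : ℝ≥0∞) * D) * γ ^ (j + 2) ≠ ⊤ := by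
  lift γ to ℝ≥0 using (hγ.trans ENNReal.one_lt_top).ne
  have hγ' : (γ : ℝ) < 1 := by exact_mod_cast hγ
  have : ∀ j : ℕ, (1 + ((j + 2 : ℕ) : ℝ≥0∞) * D) * (γ : ℝ≥0∞) ^ (j + 2) =
      (((1 + ((j + 2 : ℕ) : ℝ≥0) * D) * γ ^ (j + 2) : ℝ≥0) : ℝ≥0∞) := fun j => by push_cast; ring
  simp_rw [this]
  rw [ENNReal.tsum_coe_ne_top_iff_summable, ← NNReal.summable_coe]
  push_cast
  have h := (summable_geometric_of_lt_one γ.2 hγ').add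
    ((summable_pow_mul_geometric_of_norm_lt_one 1 (r := (γ : ℝ)) (by simpa using hγ')).mul_left
      (D : ℝ))
  refine ((summable_nat_add_iff 2).2 h).congr fun j => ?_
  simp only [pow_one, NNReal.val_eq_coe]
  push_cast
  ring

lemma iUnion_annuli {c : E n} {l : ℝ} (hl : 0 < l) :
    (cube c (2 * l))ᶜ ⊆ ⋃ j : ℕ, cube c (2 ^ (j + 2) * l) \ cube c (2 ^ (j + 1) * l) := by
  intro y hy
  have hex : ∃ j : ℕ, y ∈ cube c (2 ^ j * l) := by
    obtain ⟨j, hj⟩ := pow_unbounded_of_one_lt (‖y - c‖ * 2 / l) (one_lt_two (α := ℝ))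
    refine ⟨j, fun i => ?_⟩
    have h1 : |y i - c i| ≤ ‖y - c‖ := by simpa using PiLp.norm_apply_le (y - c) i
    rw [div_lt_iff₀ hl] at hj
    linarith
  classical
  have h1 := Nat.find_spec hex
  have h2 : 1 < Nat.find hex := by
    by_contra! h
    refine hy (cube_subset_cube c ?_ h1)
    gcongr
    calc (2 : ℝ) ^ Nat.find hex ≤ 2 ^ 1 := pow_le_pow_right₀ (by norm_num) h
      _ = 2 := by norm_num
  obtain ⟨j, hj⟩ : ∃ j, Nat.find hex = j + 2 := ⟨Nat.find hex - 2, by omega⟩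
  rw [hj] at h1
  exact Set.mem_iUnion.2 ⟨j, h1, Nat.find_min hex (by omega)⟩

/-- The pointwise bound for the far part: on the annuli the means of `b` drift linearly in `j`,
while the powers of `w` decay geometrically. -/
theorem exists_lintegral_compl_cube_le (hn : 0 < n) {p κ : ℝ} (hp : 1 < p) (hκ : κ < 1)
    {w ν : E n → ℝ} (hw : IsWeight w) (hν : IsWeight ν) {b : E n → 𝕜} (hb : MemBMO b)
    (hbump : BumpCondition p w ν) (hA : MuckenhouptAInfty w) :
    ∃ C : ℝ≥0, ∀ (f : E n → 𝕜), AEStronglyMeasurable f volume → ∀ (c : E n) (l : ℝ), 0 < l →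
      wmass w (cube c l) ≠ 0 → ∀ x ∈ cube c l,
      ∫⁻ y in (cube c (2 * l))ᶜ, ‖b x - b y‖ₑ * ‖f y‖ₑ / ‖x - y‖ₑ ^ n ≤
        C * morreyNorm p κ ν w f * wmass w (cube c l) ^ ((κ - 1) / p) *
          (1 + ‖b x - cubeMean b c l‖ₑ) := by
  obtain ⟨β, hβ, hspread⟩ := hA.exists_halfSpread hw
  obtain ⟨C, hC⟩ := hbump.exists_avg_le (κ := κ) hp hw hν hb
  have he : 0 < (1 - κ) / p := div_pos (by linarith) (by linarith)
  set e := (1 - κ) / p with he_def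
  have hee : (κ - 1) / p = -e := by rw [he_def]; ring
  have hγ : β ^ e < 1 := ENNReal.rpow_lt_one hβ he
  set D : ℝ≥0 := 2 ^ n * (bmoNorm b).toNNReal with hD_def
  have hD : 2 ^ n * bmoNorm b = (D : ℝ≥0∞) := by
    rw [hD_def]; push_cast; rw [ENNReal.coe_toNNReal hb.norm_lt_top.ne]
  set G := ∑' j : ℕ, (1 + ((j + 2 : ℕ) : ℝ≥0∞) * D) * (β ^ e) ^ (j + 2) with hG
  have hGt : G ≠ ⊤ := tsum_one_add_mul_geometric_ne_top D hγ
  refine ⟨8 ^ n * C * G.toNNReal, fun f hf c l hl h0 x hx => ?_⟩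
  set W := wmass w (cube c l) with hW
  have hWt : W ≠ ⊤ := hw.wmass_cube_ne_top c hl.le
  set N := morreyNorm p κ ν w f
  set m := cubeMean b c l
  have hterm : ∀ j : ℕ, ∫⁻ y in cube c (2 ^ (j + 2) * l) \ cube c (2 ^ (j + 1) * l),
      ‖b x - b y‖ₑ * ‖f y‖ₑ / ‖x - y‖ₑ ^ n ≤ 8 ^ n * C * N * W ^ (-e) * (1 + ‖b x - m‖ₑ) *
        ((1 + ((j + 2 : ℕ) : ℝ≥0∞) * D) * (β ^ e) ^ (j + 2)) := by
    intro j
    have hl' : 0 < 2 ^ (j + 2) * l := by positivity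
    set Q' := cube c (2 ^ (j + 2) * l)
    set m' := cubeMean b c (2 ^ (j + 2) * l)
    have hV'0 : volume Q' ≠ 0 := volume_cube_ne_zero c hl'
    have hmm : ‖m - m'‖ₑ ≤ ((j + 2 : ℕ) : ℝ≥0∞) * D := by
      rw [← hD]; exact enorm_cubeMean_sub_cubeMean_pow_le hb.locallyIntegrable c hl (j + 2)
    have hpt : ∀ y ∈ Q' \ cube c (2 ^ (j + 1) * l), ‖b x - b y‖ₑ * ‖f y‖ₑ / ‖x - y‖ₑ ^ n ≤
        8 ^ n * (1 + ‖b x - m‖ₑ) * (1 + ((j + 2 : ℕ) : ℝ≥0∞) * D) * (volume Q')⁻¹ *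
          ((1 + ‖b y - m'‖ₑ) * ‖f y‖ₑ) := by
      intro y hy
      have h1 : ‖b x - b y‖ₑ ≤ ‖b x - m‖ₑ + ‖m - m'‖ₑ + ‖b y - m'‖ₑ := by
        rw [show b x - b y = (b x - m) + (m - m') - (b y - m') by ring]
        exact enorm_sub_le.trans (add_le_add_left (enorm_add_le _ _) _)
      -- Bounding the sum by a product separates the dependence on `x`, `j` and `y`.
      have h2 : ‖b x - b y‖ₑ ≤ (1 + ‖b x - m‖ₑ) * (1 + ((j + 2 : ℕ) : ℝ≥0∞) * D) *
          (1 + ‖b y - m'‖ₑ) := by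
        refine h1.trans ((add_le_add_left (add_le_add_right hmm _) _).trans ?_)
        set s := ‖b x - m‖ₑ
        set d := ((j + 2 : ℕ) : ℝ≥0∞) * D
        set u := ‖b y - m'‖ₑ
        rw [show (1 + s) * (1 + d) * (1 + u) =
          (s + d + u) + (1 + s * d + s * u + d * u + s * d * u) by ring]
        exact le_self_add
      rw [div_eq_mul_inv]
      calc _ ≤ ((1 + ‖b x - m‖ₑ) * (1 + ((j + 2 : ℕ) : ℝ≥0∞) * D) * (1 + ‖b y - m'‖ₑ)) *
            ‖f y‖ₑ * (8 ^ n * (volume Q')⁻¹) := by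
            gcongr
            exact inv_enorm_sub_pow_le hl hx hy.2
        _ = _ := by ring
    have hWW : W ≤ β ^ (j + 2) * wmass w Q' := by
      rw [hW, wmass_eq_weightMeasure, wmass_eq_weightMeasure]
      exact hspread.cube_le_pow hn c hl (j + 2)
    have hW'0 : wmass w Q' ≠ 0 := fun h => h0 (le_zero_iff.1 (hWW.trans_eq (by simp [h])))
    have hW't : wmass w Q' ≠ ⊤ := hw.wmass_cube_ne_top c hl'.le
    -- Reverse doubling, raised to a negative power: `κ < 1` enters here through `e > 0`.
    have hW'e : wmass w Q' ^ (-e) ≤ (β ^ e) ^ (j + 2) * W ^ (-e) := by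
      have h1 := ENNReal.rpow_le_rpow hWW he.le
      rw [ENNReal.mul_rpow_of_nonneg _ _ he.le, ← ENNReal.rpow_natCast, ← ENNReal.rpow_mul,
        mul_comm _ e, ENNReal.rpow_mul, ENNReal.rpow_natCast] at h1
      have hWe0 : W ^ e ≠ 0 := (ENNReal.rpow_pos (pos_iff_ne_zero.2 h0) hWt).ne'
      have hWet : W ^ e ≠ ⊤ := ENNReal.rpow_ne_top_of_ne_zero h0 hWt
      have hW'e0 : wmass w Q' ^ e ≠ 0 := (ENNReal.rpow_pos (pos_iff_ne_zero.2 hW'0) hW't).ne'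
      have hW'et : wmass w Q' ^ e ≠ ⊤ := ENNReal.rpow_ne_top_of_ne_zero hW'0 hW't
      rw [ENNReal.rpow_neg, ENNReal.rpow_neg, ← div_eq_mul_inv,
        ENNReal.le_div_iff_mul_le (Or.inl hWe0) (Or.inl hWet), mul_comm, ← div_eq_mul_inv]
      exact (ENNReal.div_le_iff hW'e0 hW'et).2 h1
    have havg := hC f hf c _ hl' hW'0
    rw [hee] at havg
    calc _ ≤ ∫⁻ y in Q' \ cube c (2 ^ (j + 1) * l), 8 ^ n * (1 + ‖b x - m‖ₑ) *
          (1 + ((j + 2 : ℕ) : ℝ≥0∞) * D) * (volume Q')⁻¹ * ((1 + ‖b y - m'‖ₑ) * ‖f y‖ₑ) :=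
          setLIntegral_mono' ((measurableSet_cube _ _).diff (measurableSet_cube _ _)) hpt
      _ ≤ ∫⁻ y in Q', 8 ^ n * (1 + ‖b x - m‖ₑ) *
          (1 + ((j + 2 : ℕ) : ℝ≥0∞) * D) * (volume Q')⁻¹ * ((1 + ‖b y - m'‖ₑ) * ‖f y‖ₑ) :=
          lintegral_mono_set Set.sdiff_subset
      _ = 8 ^ n * (1 + ‖b x - m‖ₑ) * (1 + ((j + 2 : ℕ) : ℝ≥0∞) * D) *
          avg Q' (fun y => (1 + ‖b y - m'‖ₑ) * ‖f y‖ₑ) := by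
          rw [lintegral_const_mul' _ _ (by finiteness), avg, mul_assoc]
      _ ≤ 8 ^ n * (1 + ‖b x - m‖ₑ) * (1 + ((j + 2 : ℕ) : ℝ≥0∞) * D) *
          (C * N * ((β ^ e) ^ (j + 2) * W ^ (-e))) := by
          gcongr
          exact havg.trans (mul_le_mul_right hW'e _)
      _ = _ := by ring
  rw [hee]
  calc _ ≤ ∫⁻ y in ⋃ j : ℕ, cube c (2 ^ (j + 2) * l) \ cube c (2 ^ (j + 1) * l),
        ‖b x - b y‖ₑ * ‖f y‖ₑ / ‖x - y‖ₑ ^ n := lintegral_mono_set (iUnion_annuli hl)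
    _ ≤ ∑' j : ℕ, ∫⁻ y in cube c (2 ^ (j + 2) * l) \ cube c (2 ^ (j + 1) * l),
        ‖b x - b y‖ₑ * ‖f y‖ₑ / ‖x - y‖ₑ ^ n := lintegral_iUnion_le _ _
    _ ≤ ∑' j : ℕ, 8 ^ n * C * N * W ^ (-e) * (1 + ‖b x - m‖ₑ) *
        ((1 + ((j + 2 : ℕ) : ℝ≥0∞) * D) * (β ^ e) ^ (j + 2)) := ENNReal.tsum_le_tsum hterm
    _ = _ := by
      rw [ENNReal.tsum_mul_left, ← hG]
      push_cast
      rw [ENNReal.coe_toNNReal hGt]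
      ring

/-! ### Moments of a function of bounded mean oscillation -/

/-- Young's inequality with `u = 1` reduces the moment to the exponential integral. -/
lemma exists_lintegral_one_add_rpow_le {μ : Measure (E n)} {β : ℝ≥0∞} (hμ : HalfSpread μ β)
    (hβ : β < 1) (hac : μ ≪ volume) {b : E n → 𝕜} (hb : MemBMO b) {p : ℝ} (hp : 0 < p) :
    ∃ C : ℝ≥0, ∀ (c : E n) (l : ℝ), 0 < l →
      ∫⁻ x in cube c l, (1 + ‖b x - cubeMean b c l‖ₑ) ^ p ∂μ ≤ C * μ (cube c l) := by
  obtain ⟨θ, hθ, C₁, hC₁⟩ := hμ.exists_lintegral_exp_le hβ hac hb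
  obtain ⟨C₀, hC₀, hY⟩ := exists_rpow_le_youngLog_add_exp hp hθ
  refine ⟨C₀.toNNReal * ((youngLog p 1).toNNReal + C₁), fun c l hl => ?_⟩
  calc _ ≤ ∫⁻ x in cube c l, ENNReal.ofReal C₀ * (ENNReal.ofReal (youngLog p 1) +
        ENNReal.ofReal (Real.exp (θ * ‖b x - cubeMean b c l‖))) ∂μ := by
        refine lintegral_mono fun x => ?_
        rw [← ENNReal.ofReal_add (youngLog_nonneg zero_le_one) (Real.exp_pos _).le,
          ← ENNReal.ofReal_mul hC₀.le]
        refine le_trans ?_ (ENNReal.ofReal_le_ofReal (hY _ 1 (norm_nonneg _) zero_le_one))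
        rw [mul_one, ← ENNReal.ofReal_rpow_of_nonneg (by positivity) hp.le,
          ENNReal.ofReal_add zero_le_one (norm_nonneg _), ENNReal.ofReal_one, ofReal_norm]
    _ = ENNReal.ofReal C₀ * (ENNReal.ofReal (youngLog p 1) * μ (cube c l) +
        ∫⁻ x in cube c l, ENNReal.ofReal (Real.exp (θ * ‖b x - cubeMean b c l‖)) ∂μ) := by
        rw [lintegral_const_mul' _ _ ENNReal.ofReal_ne_top, lintegral_add_left measurable_const]
        simp
    _ ≤ ENNReal.ofReal C₀ * (ENNReal.ofReal (youngLog p 1) * μ (cube c l) +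
        C₁ * μ (cube c l)) := by
        gcongr
        exact hC₁ c l hl
    _ = _ := by
        push_cast
        simp only [ENNReal.ofReal]
        ring

/-! ### Truncations of functions in a Morrey space -/

lemma wpow_indicator_le {p : ℝ} (hp : 0 < p) (ν : E n → ℝ) (f : E n → 𝕜) (s S : Set (E n)) :
    wpow p ν (s.indicator f) S ≤ wpow p ν f S := by
  refine lintegral_mono fun x => ?_
  gcongr
  by_cases hx : x ∈ s <;> simp [hx]

lemma morreyNorm_indicator_le {p κ : ℝ} (hp : 0 < p) (ν w : E n → ℝ) (f : E n → 𝕜)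
    (s : Set (E n)) : morreyNorm p κ ν w (s.indicator f) ≤ morreyNorm p κ ν w f := by
  unfold morreyNorm
  gcongr
  exact wpow_indicator_le hp ν f s _

lemma MemMorrey.indicator {p κ : ℝ} (hp : 0 < p) {ν w : E n → ℝ} {f : E n → 𝕜}
    (hf : MemMorrey p κ ν w f) {s : Set (E n)} (hs : MeasurableSet s) :
    MemMorrey p κ ν w (s.indicator f) where
  measurable := hf.measurable.indicator hs
  locally x₀ l hl := (wpow_indicator_le hp ν f s _).trans_lt (hf.locally x₀ l hl)
  norm_lt_top := (morreyNorm_indicator_le hp ν w f s).trans_lt hf.norm_lt_top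

lemma wpow_indicator_univ {p : ℝ} (hp : 0 < p) (ν : E n → ℝ) (f : E n → 𝕜) {s : Set (E n)}
    (hs : MeasurableSet s) : wpow p ν (s.indicator f) Set.univ = wpow p ν f s := by
  rw [wpow, wpow, Measure.restrict_univ, ← lintegral_indicator hs]
  refine lintegral_congr fun x => ?_
  by_cases hx : x ∈ s <;> simp [hx, hp]

/-- The closed support stays where some coordinate differs from that of `c` by at least `l`, whereas
`l / 2` is the most that occurs in the cube. -/
lemma notMem_tsupport_indicator_compl_cube (f : E n → 𝕜) {c x : E n} {l : ℝ} (hl : 0 < l)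
    (hx : x ∈ cube c l) : x ∉ tsupport ((cube c (2 * l))ᶜ.indicator f) := by
  have hclosed : IsClosed {y : E n | ∃ i, l ≤ |y i - c i|} := by
    have : {y : E n | ∃ i, l ≤ |y i - c i|} = ⋃ i, {y : E n | l ≤ |y i - c i|} := by
      ext y; simp
    rw [this]
    exact isClosed_iUnion_of_finite fun i => isClosed_le (by fun_prop) (by fun_prop)
  have hsub : tsupport ((cube c (2 * l))ᶜ.indicator f) ⊆ {y : E n | ∃ i, l ≤ |y i - c i|} := by
    refine closure_minimal (Set.support_indicator_subset.trans fun y hy => ?_) hclosed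
    simp only [cube, Set.mem_compl_iff, Set.mem_ofPred_eq, not_forall, not_le] at hy
    obtain ⟨i, hi⟩ := hy
    exact ⟨i, by linarith⟩
  intro h
  obtain ⟨i, hi⟩ := hsub h
  linarith [hx i]

lemma lintegral_commutator_indicator (b f : E n → 𝕜) {s : Set (E n)} (hs : MeasurableSet s)
    (x : E n) : ∫⁻ y, ‖b x - b y‖ₑ * ‖s.indicator f y‖ₑ / ‖x - y‖ₑ ^ n =
      ∫⁻ y in s, ‖b x - b y‖ₑ * ‖f y‖ₑ / ‖x - y‖ₑ ^ n := by
  rw [← lintegral_indicator hs]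
  refine lintegral_congr fun y => ?_
  by_cases hy : y ∈ s <;> simp [hy]

lemma lt_or_lt_of_lt_add {σ a b : ℝ} (h : σ < a + b) : σ / 2 < a ∨ σ / 2 < b := by
  by_contra! h'
  linarith [h'.1, h'.2]

end WeightedMorrey

/-! ### The weak Morrey bound: local and far parts -/

theorem theorem1p3 {𝕜 : Type*} [RCLike 𝕜] {n : ℕ} (hn : 0 < n)
    {p κ : ℝ} (hp : 1 < p) (hκ₀ : 0 < κ) (hκ₁ : κ < 1)
    {w ν : E n → ℝ} (hw : IsWeight w) (hν : IsWeight ν)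
    {b : E n → 𝕜} (hb : MemBMO b)
    -- the operator `[b, 𝒯]`
    (S : (E n → 𝕜) → E n → 𝕜)
    (hS : IsSublinearOn (MemMorrey p κ ν w) S)
    (hsize : CommutatorSize
      (fun f => (Integrable f volume ∧ HasCompactSupport f) ∨ MemMorrey p κ ν w f) b S)
    (hbump : BumpCondition p w ν)
    (hweak : WeakType p ν w S)
    (hA : MuckenhouptAInfty w) :
    BoundedMorreyToWeak p κ ν w S := by
  have hp0 : 0 < p := by linarith
  obtain ⟨c₃, hsize⟩ := hsize
  obtain ⟨Cw, hweak⟩ := hweak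
  obtain ⟨Cd, hdoubling⟩ := hA.exists_doubling hw
  obtain ⟨Ct, htail⟩ := exists_lintegral_compl_cube_le hn hp hκ₁ hw hν hb hbump hA
  obtain ⟨β, hβ, hspread⟩ := hA.exists_halfSpread hw
  have hac := weightMeasure_absolutelyContinuous w
  obtain ⟨Cm, hmoment⟩ := exists_lintegral_one_add_rpow_le hspread hβ hac hb hp0
  -- The first summand is the constant of the local part, the second that of the far part.
  set G : ℝ≥0∞ := Cw * (Cd : ℝ≥0∞) ^ κ + (c₃ * Ct : ℝ≥0∞) ^ p * Cm with hG
  have hGt : G ^ (1 / p) ≠ ⊤ := by finiteness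
  have key : ∀ f, MemMorrey p κ ν w f → ∀ (c : E n) (l : ℝ), 0 < l → ∀ σ : ℝ, 0 < σ →
      wmass w (cube c l) ≠ 0 →
      ENNReal.ofReal (σ / 2) ^ p * wmass w {x | x ∈ cube c l ∧ σ < ‖S f x‖} ≤
        G * (morreyNorm p κ ν w f ^ p * wmass w (cube c l) ^ κ) := by
    intro f hf c l hl σ hσ h0
    set W := wmass w (cube c l) with hW
    have hWt : W ≠ ⊤ := hw.wmass_cube_ne_top c hl.le
    set N := morreyNorm p κ ν w f
    set Q₂ := cube c (2 * l) with hQ₂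
    have hQ₂m : MeasurableSet Q₂ := measurableSet_cube _ _
    set f₁ := Q₂.indicator f
    set f₂ := Q₂ᶜ.indicator f
    have hf₁ : MemMorrey p κ ν w f₁ := hf.indicator hp0 hQ₂m
    have hf₂ : MemMorrey p κ ν w f₂ := hf.indicator hp0 hQ₂m.compl
    set s : ℝ≥0∞ := ENNReal.ofReal (σ / 2) with hs
    have hs0 : s ≠ 0 := (ENNReal.ofReal_pos.2 (by positivity)).ne'
    have hst : s ≠ ⊤ := ENNReal.ofReal_ne_top
    have hsp0 : s ^ p ≠ 0 := (ENNReal.rpow_pos (pos_iff_ne_zero.2 hs0) hst).ne'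
    have hspt : s ^ p ≠ ⊤ := by finiteness
    have hsplit : wmass w {x | x ∈ cube c l ∧ σ < ‖S f x‖} ≤
        wmass w {x | σ / 2 < ‖S f₁ x‖} + wmass w {x | x ∈ cube c l ∧ σ / 2 < ‖S f₂ x‖} := by
      have hadd := hS.add_le f₁ f₂ hf₁ hf₂
      rw [Set.indicator_self_add_compl] at hadd
      simp only [wmass_eq_weightMeasure]
      refine le_trans (measure_mono_ae ?_) (measure_union_le _ _)
      filter_upwards [hac hadd] with x hx hxσ
      rcases lt_or_lt_of_lt_add (hxσ.2.trans_le hx) with h | h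
      · exact Or.inl h
      · exact Or.inr ⟨hxσ.1, h⟩
    have hlocal : s ^ p * wmass w {x | σ / 2 < ‖S f₁ x‖} ≤
        Cw * (Cd : ℝ≥0∞) ^ κ * (N ^ p * W ^ κ) := by
      have hwp : wpow p ν f₁ Set.univ = wpow p ν f Q₂ := wpow_indicator_univ hp0 ν f hQ₂m
      have hlp : MemWeightedLp p ν f₁ :=
        ⟨hf₁.measurable, hwp.trans_lt (hf.locally c (2 * l) (by positivity))⟩
      have hW₂ : wmass w Q₂ ≠ 0 := fun h => h0 (le_zero_iff.1
        ((lintegral_mono_set (cube_subset_cube c (by linarith))).trans_eq h))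
      have h1 := ENNReal.rpow_le_rpow (wpow_rpow_le_morreyNorm (κ := κ) hp0 hw (ν := ν) f c
        (show 0 < 2 * l by positivity) hW₂) hp0.le
      rw [← ENNReal.rpow_mul, one_div_mul_cancel hp0.ne', ENNReal.rpow_one,
        ENNReal.mul_rpow_of_nonneg _ _ hp0.le, ← ENNReal.rpow_mul, div_mul_cancel₀ _ hp0.ne'] at h1
      have h2 := hweak f₁ hlp (σ / 2) (by positivity)
      rw [hwp] at h2
      calc _ ≤ s ^ p * (Cw / s ^ p * wpow p ν f Q₂) := by gcongr
        _ = Cw * wpow p ν f Q₂ := by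
          rw [← mul_assoc, ENNReal.mul_div_cancel hsp0 hspt]
        _ ≤ Cw * (N ^ p * (Cd * W) ^ κ) := by
          gcongr
          refine h1.trans ?_
          gcongr
          exact hdoubling c l hl
        _ = _ := by
          rw [ENNReal.mul_rpow_of_nonneg _ _ hκ₀.le]; ring
    have hfar : s ^ p * wmass w {x | x ∈ cube c l ∧ σ / 2 < ‖S f₂ x‖} ≤
        (c₃ * Ct : ℝ≥0∞) ^ p * Cm * (N ^ p * W ^ κ) := by
      set g : E n → ℝ≥0∞ := fun x => c₃ * (Ct * N * W ^ ((κ - 1) / p) *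
        (1 + ‖b x - cubeMean b c l‖ₑ)) with hg
      have hgm : AEMeasurable g (weightMeasure w) :=
        ((((hb.locallyIntegrable.aestronglyMeasurable.mono_ac hac).sub
          aestronglyMeasurable_const).enorm.const_add 1).const_mul _).const_mul _
      have hle : ∀ᵐ x ∂weightMeasure w, x ∈ cube c l → ‖S f₂ x‖ₑ ≤ g x := by
        refine hac ?_
        filter_upwards [hsize f₂ (Or.inr hf₂)] with x hx hxQ
        refine (hx (notMem_tsupport_indicator_compl_cube f hl hxQ)).trans ?_
        rw [lintegral_commutator_indicator b f hQ₂m.compl x]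
        exact mul_le_mul_right (htail f hf.measurable c l hl h0 x hxQ) _
      -- Chebyshev's inequality for the majorant `g`, which is measurable and carries all the
      -- dependence on `b`.
      calc _ ≤ s ^ p * (weightMeasure w).restrict (cube c l) {x | s ^ p ≤ g x ^ p} := by
            rw [wmass_eq_weightMeasure, Measure.restrict_apply' (measurableSet_cube c l)]
            gcongr 1
            refine measure_mono_ae ?_
            filter_upwards [hle] with x hx ⟨hxQ, hxσ⟩
            refine ⟨?_, hxQ⟩
            refine ENNReal.rpow_le_rpow (le_trans ?_ (hx hxQ)) hp0.le
            rw [hs, ← ofReal_norm]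
            exact ENNReal.ofReal_le_ofReal hxσ.le
        _ ≤ ∫⁻ x in cube c l, g x ^ p ∂weightMeasure w :=
            mul_meas_ge_le_lintegral₀ (hgm.pow_const p).restrict _
        _ = (c₃ * Ct * N * W ^ ((κ - 1) / p)) ^ p *
            ∫⁻ x in cube c l, (1 + ‖b x - cubeMean b c l‖ₑ) ^ p ∂weightMeasure w := by
            have hNt : N ≠ ⊤ := hf.norm_lt_top.ne
            have hWe : W ^ ((κ - 1) / p) ≠ ⊤ := ENNReal.rpow_ne_top_of_ne_zero h0 hWt
            rw [← lintegral_const_mul' _ _ (by finiteness)]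
            refine lintegral_congr fun x => ?_
            rw [← ENNReal.mul_rpow_of_nonneg _ _ hp0.le, hg]
            ring_nf
        _ ≤ (c₃ * Ct * N * W ^ ((κ - 1) / p)) ^ p * (Cm * W) := by
            gcongr
            rw [hW, wmass_eq_weightMeasure]
            exact hmoment c l hl
        _ = (c₃ * Ct : ℝ≥0∞) ^ p * Cm * (N ^ p * (W ^ (κ - 1) * W ^ (1 : ℝ))) := by
            rw [ENNReal.mul_rpow_of_nonneg _ _ hp0.le, ENNReal.mul_rpow_of_nonneg _ N hp0.le,
              ← ENNReal.rpow_mul, div_mul_cancel₀ _ hp0.ne', ENNReal.rpow_one]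
            ring
        _ = _ := by
            rw [← ENNReal.rpow_add _ _ h0 hWt, sub_add_cancel]
    calc _ ≤ s ^ p * (wmass w {x | σ / 2 < ‖S f₁ x‖} +
          wmass w {x | x ∈ cube c l ∧ σ / 2 < ‖S f₂ x‖}) := by gcongr
      _ ≤ _ := by
        rw [mul_add, hG, add_mul]
        exact add_le_add hlocal hfar
  have hbound : ∀ f, MemMorrey p κ ν w f →
      weakMorreyNorm p κ w (S f) ≤ 2 * G ^ (1 / p) * morreyNorm p κ ν w f := by
    intro f hf
    refine iSup_le fun c => iSup_le fun l => iSup_le fun hl => iSup_le fun σ => iSup_le fun hσ => ?_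
    set W := wmass w (cube c l) with hW
    have hWt : W ≠ ⊤ := hw.wmass_cube_ne_top c hl.le
    -- On a cube of zero mass the inverse power is `∞`, but the level set has mass `0` and the
    -- product vanishes.
    by_cases h0 : W = 0
    · have : wmass w {x | x ∈ cube c l ∧ σ < ‖S f x‖} = 0 :=
        le_zero_iff.1 ((lintegral_mono_set fun x hx => hx.1).trans_eq h0)
      simp [this, hp0]
    · have h1 := ENNReal.rpow_le_rpow (key f hf c l hl σ hσ h0) (show 0 ≤ 1 / p by positivity)
      rw [ENNReal.mul_rpow_of_nonneg _ _ (by positivity), ← ENNReal.rpow_mul,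
        mul_one_div_cancel hp0.ne', ENNReal.rpow_one,
        ENNReal.mul_rpow_of_nonneg _ _ (by positivity), ENNReal.mul_rpow_of_nonneg _ _ (by positivity), ← ENNReal.rpow_mul,
        mul_one_div_cancel hp0.ne', ENNReal.rpow_one, ← ENNReal.rpow_mul, mul_one_div] at h1
      have hσ2 : ENNReal.ofReal σ = 2 * ENNReal.ofReal (σ / 2) := by
        rw [← ENNReal.ofReal_ofNat, ← ENNReal.ofReal_mul zero_le_two]
        congr 1; ring
      have hWk0 : W ^ (κ / p) ≠ 0 := (ENNReal.rpow_pos (pos_iff_ne_zero.2 h0) hWt).ne'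
      have hWkt : W ^ (κ / p) ≠ ⊤ := ENNReal.rpow_ne_top_of_ne_zero h0 hWt
      rw [hσ2]
      calc _ = (W ^ (κ / p))⁻¹ * 2 * (ENNReal.ofReal (σ / 2) *
            wmass w {x | x ∈ cube c l ∧ σ < ‖S f x‖} ^ (1 / p)) := by ring
        _ ≤ (W ^ (κ / p))⁻¹ * 2 * (G ^ (1 / p) * (morreyNorm p κ ν w f * W ^ (κ / p))) := by
          gcongr
        _ = 2 * G ^ (1 / p) * morreyNorm p κ ν w f * ((W ^ (κ / p))⁻¹ * W ^ (κ / p)) := by ring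
        _ = _ := by rw [ENNReal.inv_mul_cancel hWk0 hWkt, mul_one]
  refine ⟨2 * (G ^ (1 / p)).toNNReal, fun f hf => ?_⟩
  have hC : ((2 * (G ^ (1 / p)).toNNReal : ℝ≥0) : ℝ≥0∞) = 2 * G ^ (1 / p) := by
    push_cast; rw [ENNReal.coe_toNNReal hGt]
  rw [hC]
  refine ⟨⟨hS.measurable f hf, (hbound f hf).trans_lt ?_⟩, hbound f hf⟩
  exact ENNReal.mul_lt_top (by finiteness) hf.norm_lt_top
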